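/- Let $n\ge 1$, let $\Omega\subset\mathbb{R}^n$ be a bounded Lipschitz domain and let $\varepsilon>0$. Let $\phi_1,\phi_2,\phi_3\in H^{1/2}(\partial\Omega)\cap L^\infty(\partial\Omega)$ with $\phi_i\ge 0$ a.e. on $\partial\Omega$, and set $$M:=\max_{i=1,2,3}\|\phi_i\|_{L^\infty(\partial\Omega)},\qquad X:=(L^2(\Omega))^3,\qquad K:=\{u\in X:\ 0\le u_i\le M\ \text{a.e. in }\Omega,\ i=1,2,3\}.$$ All Dirichlet problems below are understood weakly: for a coefficient $q$, a function $z\in H^1(\Omega)$ solves $-\Delta z+\frac{q}{\varepsilon}z=0$ in $\Omega$, $z|_{\partial\Omega}=\phi$, if its trace is $\phi$ and $\int_\Omega\nabla z\cdot\nabla\psi\,dx+\int_\Omega\frac{q}{\varepsilon}z\psi\,dx=0$ for all $\psi\in H^1_0(\Omega)$. For $u\in K$, the Jacobi/Picard map $T$ is defined by $T(u)=v$, where $$-\Delta v_i+\frac{(u_ju_\ell)^2}{\varepsilon}v_i=0\ \text{in }\Omega,\qquad v_i|_{\partial\Omega}=\phi_i,\qquad \{i,j,\ell\}=\{1,2,3\},$$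 and the Gauss–Seidel map $G$ is defined by $G(u)=v$, where successively $$-\Delta v_1+\frac{(u_2u_3)^2}{\varepsilon}v_1=0,\qquad v_1|_{\partial\Omega}=\phi_1,$$ $$-\Delta v_2+\frac{u_3^2(u_1^2+v_1^2)}{2\varepsilon}v_2=0,\qquad v_2|_{\partial\Omega}=\phi_2,$$ $$-\Delta v_3+\frac{(u_1u_2)^2+(v_1v_2)^2}{2\varepsilon}v_3=0,\qquad v_3|_{\partial\Omega}=\phi_3.$$ Then for every $u\in K$ each of these two systems has exactly one solution $v\in X$ (so that $T$ and $G$ are well defined on $K$), and $T(u)\in K$ and $G(u)\in K$. -/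

import Mathlib

open MeasureTheory Set Filter Topology
open scoped ContDiff ENNReal NNReal

noncomputable section

namespace Segregation

/-- Euclidean space `ℝⁿ`. -/
abbrev E (n : ℕ) : Type := EuclideanSpace ℝ (Fin n)

/-- The real Lebesgue space `L²(Ω)`. -/
abbrev L2 {n : ℕ} (Ω : Set (E n)) : Type := Lp ℝ 2 (volume.restrict Ω)

/-- The space `L²(Ω; ℝⁿ)` of square integrable vector fields. -/
abbrev L2Vec {n : ℕ} (Ω : Set (E n)) : Type := Lp (E n) 2 (volume.restrict Ω)

/-- The Banach space `X = L²(Ω)³` (with the maximum of the three `L²` norms as norm). -/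
abbrev X {n : ℕ} (Ω : Set (E n)) : Type := Fin 3 → L2 Ω

/-- `Ω` is a bounded Lipschitz domain in `ℝⁿ`: a bounded connected open set such that near every
boundary point, in suitable orthonormal coordinates `(y', yₙ) ∈ ℝⁿ⁻¹ × ℝ`, the set `Ω` is
the open region above the graph of a Lipschitz function of `y'`. -/
structure IsBoundedLipschitzDomain {n : ℕ} (Ω : Set (E n)) : Prop where
  isOpen : IsOpen Ω
  isConnected : IsConnected Ω
  isBounded : Bornology.IsBounded Ω
  lipschitz_boundary : ∀ x ∈ frontier Ω,
    ∃ (A : E n ≃ₗᵢ[ℝ] WithLp 2 (E (n - 1) × ℝ)) (γ : E (n - 1) → ℝ) (L : ℝ≥0) (r : ℝ),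
      LipschitzWith L γ ∧ 0 < r ∧
        ∀ y ∈ Metric.ball x r, y ∈ Ω ↔ γ (A y).fst < (A y).snd

/-- The surface measure on `∂Ω`: the `(n-1)`-dimensional Hausdorff measure restricted to the
boundary (its normalization is irrelevant for everything below). -/
def surfaceMeasure {n : ℕ} (Ω : Set (E n)) : Measure (E n) :=
  (Measure.hausdorffMeasure ((n : ℝ) - 1)).restrict (frontier Ω)

/-- `ψ ∈ C_c^∞(Ω)`. -/
structure IsTestFunction {n : ℕ} (Ω : Set (E n)) (ψ : E n → ℝ) : Prop where
  contDiff : ContDiff ℝ ∞ ψ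
  hasCompactSupport : HasCompactSupport ψ
  tsupport_subset : tsupport ψ ⊆ Ω

/-- `g` is the weak gradient of `u` in `Ω`. As both are square integrable, this says that
`u ∈ H¹(Ω)` and `∇u = g`. -/
def HasWeakGradient {n : ℕ} (Ω : Set (E n)) (u : L2 Ω) (g : L2Vec Ω) : Prop :=
  ∀ ψ : E n → ℝ, IsTestFunction Ω ψ →
    ∫ x in Ω, u x • gradient ψ x = -∫ x in Ω, ψ x • g x

/-- The functions `ζ k` (smooth in the uses below) converge in `H¹(Ω)` to the function `u` with
weak gradient `g`. -/
def TendstoH1 {n : ℕ} (Ω : Set (E n)) (ζ : ℕ → E n → ℝ) (u : L2 Ω) (g : L2Vec Ω) : Prop :=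
  Tendsto (fun k => eLpNorm (fun x => ζ k x - u x) 2 (volume.restrict Ω)) atTop (𝓝 0) ∧
  Tendsto (fun k => eLpNorm (fun x => gradient (ζ k) x - g x) 2 (volume.restrict Ω)) atTop (𝓝 0)

/-- `ψ ∈ H₀¹(Ω)` with weak gradient `h`, where `H₀¹(Ω)` is the closure of `C_c^∞(Ω)` in
`H¹(Ω)`. -/
def MemH10 {n : ℕ} (Ω : Set (E n)) (ψ : L2 Ω) (h : L2Vec Ω) : Prop :=
  HasWeakGradient Ω ψ h ∧
    ∃ ζ : ℕ → E n → ℝ, (∀ k, IsTestFunction Ω (ζ k)) ∧ TendstoH1 Ω ζ ψ h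

/-- `u ∈ H¹(Ω)` has trace `φ ∈ L²(∂Ω)` on the boundary. The trace is the continuous extension
to `H¹(Ω)` of the restriction map `ζ ↦ ζ|_∂Ω` on functions that are smooth up to the boundary;
that is, `u` is an `H¹(Ω)`-limit of smooth functions whose restrictions to `∂Ω` converge to `φ`
in `L²(∂Ω)`. -/
def HasTrace {n : ℕ} (Ω : Set (E n)) (u : L2 Ω) (φ : E n → ℝ) : Prop :=
  MemLp φ 2 (surfaceMeasure Ω) ∧
  ∃ g : L2Vec Ω, HasWeakGradient Ω u g ∧
    ∃ ζ : ℕ → E n → ℝ, (∀ k, ContDiff ℝ ∞ (ζ k)) ∧ TendstoH1 Ω ζ u g ∧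
      Tendsto (fun k => eLpNorm (fun x => ζ k x - φ x) 2 (surfaceMeasure Ω)) atTop (𝓝 0)

/-- `φ ∈ H^{1/2}(∂Ω)`, the space of traces of functions in `H¹(Ω)`. -/
def MemHHalf {n : ℕ} (Ω : Set (E n)) (φ : E n → ℝ) : Prop :=
  ∃ u : L2 Ω, HasTrace Ω u φ

/-- `z ∈ H¹(Ω)` is a weak solution of `-Δz + (q/ε) z = 0` in `Ω`:
`∫ ∇z·∇ψ + ∫ (q/ε) z ψ = 0` for all `ψ ∈ H₀¹(Ω)`. -/
def IsWeakSolution {n : ℕ} (Ω : Set (E n)) (ε : ℝ) (q : E n → ℝ) (z : L2 Ω) : Prop :=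
  ∃ g : L2Vec Ω, HasWeakGradient Ω z g ∧
    ∀ (ψ : L2 Ω) (h : L2Vec Ω), MemH10 Ω ψ h →
      (∫ x in Ω, inner ℝ (g x) (h x)) + ∫ x in Ω, q x / ε * z x * ψ x = 0

/-- `z` solves `-Δz + (q/ε) z = 0` weakly in `Ω`, with `z = φ` on `∂Ω` in the sense of traces. -/
def SolvesDirichlet {n : ℕ} (Ω : Set (E n)) (ε : ℝ) (q φ : E n → ℝ) (z : L2 Ω) : Prop :=
  IsWeakSolution Ω ε q z ∧ HasTrace Ω z φ

/-- `M = max_i ‖φ_i‖_{L^∞(∂Ω)}`. -/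
def bound {n : ℕ} (Ω : Set (E n)) (φ : Fin 3 → E n → ℝ) : ℝ :=
  Finset.univ.sup' Finset.univ_nonempty
    fun i : Fin 3 => (eLpNorm (φ i) ∞ (surfaceMeasure Ω)).toReal

/-- The order interval `K = {u ∈ X : 0 ≤ u_i ≤ M a.e. in Ω}`. -/
def orderInterval {n : ℕ} (Ω : Set (E n)) (φ : Fin 3 → E n → ℝ) : Set (X Ω) :=
  {u | ∀ i, ∀ᵐ x ∂(volume.restrict Ω), 0 ≤ u i x ∧ u i x ≤ bound Ω φ}

/-- The system defining `v = T(u)`. The indices other than `i : Fin 3` are `i + 1` and `i + 2`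
(addition modulo `3`). -/
def IsJacobiStep {n : ℕ} (Ω : Set (E n)) (ε : ℝ) (φ : Fin 3 → E n → ℝ) (u v : X Ω) : Prop :=
  ∀ i : Fin 3,
    SolvesDirichlet Ω ε (fun x => (u (i + 1) x * u (i + 2) x) ^ 2) (φ i) (v i)

/-- The sequential system defining `v = G(u)`. The three components are indexed by `0, 1, 2`. -/
def IsGaussSeidelStep {n : ℕ} (Ω : Set (E n)) (ε : ℝ) (φ : Fin 3 → E n → ℝ) (u v : X Ω) :
    Prop :=
  SolvesDirichlet Ω ε (fun x => (u 1 x * u 2 x) ^ 2) (φ 0) (v 0) ∧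
  SolvesDirichlet Ω ε (fun x => u 2 x ^ 2 * (u 0 x ^ 2 + v 0 x ^ 2) / 2) (φ 1) (v 1) ∧
  SolvesDirichlet Ω ε (fun x => ((u 0 x * u 1 x) ^ 2 + (v 0 x * v 1 x) ^ 2) / 2) (φ 2) (v 2)

/-- The Jacobi/Picard map `T`: it sends `u` to a solution `v` of the Jacobi system (arbitrary value
if there is none; existence and uniqueness for `u ∈ K` are part of the theorem). -/
def jacobiMap {n : ℕ} (Ω : Set (E n)) (ε : ℝ) (φ : Fin 3 → E n → ℝ) (u : X Ω) : X Ω :=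
  Classical.epsilon fun v => IsJacobiStep Ω ε φ u v

/-- The Gauss–Seidel map `G`: it sends `u` to a solution `v` of the Gauss–Seidel system (arbitrary
value if there is none; existence and uniqueness for `u ∈ K` are part of the theorem). -/
def gaussSeidelMap {n : ℕ} (Ω : Set (E n)) (ε : ℝ) (φ : Fin 3 → E n → ℝ) (u : X Ω) : X Ω :=
  Classical.epsilon fun v => IsGaussSeidelStep Ω ε φ u v

end Segregation

end

/-! With `u` frozen, every equation is a linear problem -Δz + bz = 0 with a bounded coefficient b ≥
0, so everything reduces to one scalar statement, `existsUnique_solvesDirichlet`: unique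
solvability, with values in [0, M].

Existence is Lax–Milgram on H₀¹ (`exists_correction`): subtract an extension u₀ of the boundary
data. Coercivity comes from Poincaré's inequality, since b ≥ 0 only helps. The bounds come from the
weak maximum principle `SolvesDirichlet.ae_le`: test the equation with F(z), where F is a smooth
ramp vanishing up to the level m. The two integrals are then nonnegative with sum zero, so F(z) = 0,
that is, z ≤ m. Applied with m = 0 to differences of solutions this gives uniqueness, and applied to
-z it gives nonnegativity.

The difficulty is that F(z) must be an admissible test function. Traces are defined by limits of
smooth functions and H₀¹ by limits of test functions, so one needs `memH10_of_tendsto_zero`: zero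
trace implies membership in H₀¹. This is where the Lipschitz boundary enters. In a strip of width t
the squared L² norm is at most a constant times t times the squared boundary norm plus t² times the
squared gradient norm in a wider strip (`exists_strip_estimate`), which pays for the gradient, of
order 1/t, of a cutoff function.

For the Gauss–Seidel map the bounds on the components already found make the next coefficient
bounded. -/

noncomputable section

namespace Segregation

/-! ### Calculus rules for the gradient. -/

section Gradient

variable {n : ℕ}

lemma inner_gradient (f : E n → ℝ) (x v : E n) : inner ℝ (gradient f x) v = fderiv ℝ f x v := by
  simp [gradient, InnerProductSpace.toDual_symm_apply]

lemma norm_gradient (f : E n → ℝ) (x : E n) : ‖gradient f x‖ = ‖fderiv ℝ f x‖ := by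
  simp [gradient]

lemma gradient_mul {f g : E n → ℝ} {x : E n} (hf : DifferentiableAt ℝ f x)
    (hg : DifferentiableAt ℝ g x) :
    gradient (fun y => f y * g y) x = f x • gradient g x + g x • gradient f x := by
  simp [gradient, fderiv_fun_mul hf hg]

lemma gradient_comp {F : ℝ → ℝ} {f : E n → ℝ} {x : E n} (hF : DifferentiableAt ℝ F (f x))
    (hf : DifferentiableAt ℝ f x) :
    gradient (fun y => F (f y)) x = deriv F (f x) • gradient f x := by
  have : fderiv ℝ (fun y => F (f y)) x = deriv F (f x) • fderiv ℝ f x :=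
    (hF.hasDerivAt.comp_hasFDerivAt x hf.hasFDerivAt).fderiv
  simp [gradient, this]

lemma gradient_add {f g : E n → ℝ} {x : E n} (hf : DifferentiableAt ℝ f x)
    (hg : DifferentiableAt ℝ g x) :
    gradient (fun y => f y + g y) x = gradient f x + gradient g x := by
  simp [gradient, fderiv_fun_add hf hg]

lemma gradient_const_mul {f : E n → ℝ} {x : E n} (c : ℝ) (hf : DifferentiableAt ℝ f x) :
    gradient (fun y => c * f y) x = c • gradient f x := by
  simp [gradient, fderiv_const_mul hf]

lemma continuous_gradient {f : E n → ℝ} (hf : ContDiff ℝ ∞ f) : Continuous (gradient f) :=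
  (InnerProductSpace.toDual ℝ (E n)).symm.continuous.comp (hf.continuous_fderiv (by simp))

end Gradient

lemma eLpNorm_two_sq {α F : Type*} [MeasurableSpace α] [NormedAddCommGroup F] (μ : Measure α)
    (f : α → F) : eLpNorm f 2 μ ^ 2 = ∫⁻ x, ‖f x‖ₑ ^ 2 ∂μ := by
  have := eLpNorm_nnreal_pow_eq_lintegral (μ := μ) (f := f) (p := 2) (by norm_num)
  simpa using this

/-! ### Mollification and cutoff functions. -/

section Cutoff

variable {n : ℕ}

/-- Convolution with a probability density preserves pointwise bounds and Lipschitz constants. -/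
lemma exists_smooth_approx (f : E n → ℝ) (K : ℝ≥0) (hf : LipschitzWith K f)
    (h0 : ∀ x, 0 ≤ f x) (h1 : ∀ x, f x ≤ 1) (δ : ℝ) (hδ : 0 < δ) :
    ∃ χ : E n → ℝ, ContDiff ℝ ∞ χ ∧ (∀ x, 0 ≤ χ x) ∧ (∀ x, χ x ≤ 1) ∧ LipschitzWith K χ ∧
      ∀ x, (∀ y ∈ Metric.ball x δ, f y = f x) → χ x = f x := by
  -- The outer radius δ makes the average at x see only the ball of radius δ, which gives the last
  -- claim; the inner radius is arbitrary.
  let φ : ContDiffBump (0 : E n) := ⟨δ / 2, δ, by positivity, by linarith⟩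
  let k : E n → ℝ := φ.normed volume
  have hk : Continuous k := (φ.contDiff_normed (n := 0)).continuous
  have hks : HasCompactSupport k := φ.hasCompactSupport_normed
  have hk0 : ∀ x, 0 ≤ k x := fun x => φ.nonneg_normed x
  have hk1 : ∫ x, k x = 1 := φ.integral_normed
  have hki : Integrable k := hk.integrable_of_hasCompactSupport hks
  have hint : ∀ x, Integrable fun s => k s * f (x - s) := fun x =>
    (hk.mul (hf.continuous.comp (by fun_prop))).integrable_of_hasCompactSupport hks.mul_right
  let χ : E n → ℝ := convolution k f (ContinuousLinearMap.lsmul ℝ ℝ) volume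
  have hχ : ∀ x, χ x = ∫ s, k s * f (x - s) := fun x => by
    simp [χ, convolution_def]
  refine ⟨χ, ?_, ?_, ?_, ?_, ?_⟩
  · exact hks.contDiff_convolution_left _ φ.contDiff_normed hf.continuous.locallyIntegrable
  · intro x
    rw [hχ]
    exact integral_nonneg fun s => mul_nonneg (hk0 s) (h0 _)
  · intro x
    rw [hχ, ← hk1]
    exact integral_mono (hint x) hki fun s => mul_le_of_le_one_right (hk0 s) (h1 _)
  · refine LipschitzWith.of_dist_le_mul fun x y => ?_
    rw [hχ, hχ, Real.dist_eq, ← integral_sub (hint x) (hint y)]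
    calc |∫ s, k s * f (x - s) - k s * f (y - s)|
        ≤ ∫ s, ‖k s * f (x - s) - k s * f (y - s)‖ := by
          rw [← Real.norm_eq_abs]; exact norm_integral_le_integral_norm _
      _ ≤ ∫ s, k s * (K * dist x y) := by
          refine integral_mono ((hint x).sub (hint y)).norm (hki.mul_const _) fun s => ?_
          simp only [← mul_sub, norm_mul, Real.norm_eq_abs, abs_of_nonneg (hk0 s)]
          refine mul_le_mul_of_nonneg_left ?_ (hk0 s)
          simpa [Real.dist_eq] using hf.dist_le_mul (x - s) (y - s)
      _ = K * dist x y := by rw [integral_mul_const, hk1, one_mul]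
  · intro x hx
    exact φ.normed_convolution_eq_right hx

/-- A smooth cutoff function that lives at distance at least `t / 4` from the complement of a
bounded open set and equals `1` at distance `t`. -/
lemma exists_smooth_cutoff {Ω : Set (E n)} (hΩ : Bornology.IsBounded Ω)
    {t : ℝ} (ht : 0 < t) :
    ∃ χ : E n → ℝ, IsTestFunction Ω χ ∧ (∀ x, 0 ≤ χ x) ∧ (∀ x, χ x ≤ 1) ∧
      (∀ x, ‖gradient χ x‖ ≤ 4 / t) ∧ ∀ x, t ≤ Metric.infDist x Ωᶜ → χ x = 1 := by
  let d : E n → ℝ := fun x => Metric.infDist x Ωᶜ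
  have hd : LipschitzWith 1 d := Metric.lipschitz_infDist_pt _
  let K : ℝ≥0 := ⟨4 / t, by positivity⟩
  -- A ramp of slope 4/t in the distance d, equal to 0 for d ≤ t/2 and to 1 for d ≥ 3t/4. The
  -- margins of t/4 on either side are used up by mollifying at scale t/4.
  let f : E n → ℝ := fun x => max (min (4 / t * d x - 2) 1) 0
  have hf : LipschitzWith K f := by
    refine LipschitzWith.max_const (LipschitzWith.min_const ?_ 1) 0
    refine LipschitzWith.of_dist_le_mul fun x y => ?_
    have := hd.dist_le_mul x y
    simp only [Real.dist_eq, NNReal.coe_one, one_mul] at this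
    rw [Real.dist_eq, show 4 / t * d x - 2 - (4 / t * d y - 2) = 4 / t * (d x - d y) by ring,
      abs_mul, abs_of_pos (by positivity : 0 < 4 / t)]
    exact mul_le_mul_of_nonneg_left this (by positivity)
  have hfzero : ∀ x, d x ≤ t / 2 → f x = 0 := fun x hx => by
    have : 4 / t * d x ≤ 4 / t * (t / 2) := by gcongr
    have h2 : 4 / t * (t / 2) = 2 := by field_simp; norm_num
    exact max_eq_right ((min_le_left _ _).trans (by linarith))
  have hfone : ∀ x, 3 * t / 4 ≤ d x → f x = 1 := fun x hx => by
    have : 4 / t * (3 * t / 4) ≤ 4 / t * d x := by gcongr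
    have h2 : 4 / t * (3 * t / 4) = 3 := by field_simp
    have h3 : min (4 / t * d x - 2) 1 = 1 := min_eq_right (by linarith)
    simp [f, h3]
  obtain ⟨χ, hχs, hχ0, hχ1, hχL, hχf⟩ := exists_smooth_approx f K hf (fun x => le_max_right _ _)
    (fun x => max_le (min_le_right _ _) zero_le_one) (t / 4) (by positivity)
  have hdist : ∀ x, ∀ y ∈ Metric.ball x (t / 4), |d y - d x| < t / 4 := fun x y hy => by
    have := hd.dist_le_mul y x
    simp only [Real.dist_eq, NNReal.coe_one, one_mul] at this
    exact this.trans_lt hy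
  have hzero : ∀ x, d x ≤ t / 4 → χ x = 0 := fun x hx => by
    have hfx := hfzero x (by linarith)
    rw [hχf x fun y hy => ?_, hfx]
    have := abs_lt.1 (hdist x y hy)
    rw [hfx, hfzero y (by linarith)]
  have hone : ∀ x, t ≤ d x → χ x = 1 := fun x hx => by
    have hfx := hfone x (by linarith)
    rw [hχf x fun y hy => ?_, hfx]
    have := abs_lt.1 (hdist x y hy)
    rw [hfx, hfone y (by linarith)]
  have hsub : tsupport χ ⊆ {x | t / 4 ≤ d x} := by
    refine closure_minimal (fun x hx => ?_) (isClosed_le continuous_const hd.continuous)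
    by_contra h
    exact hx (hzero x (not_le.1 h).le)
  have hsubΩ : tsupport χ ⊆ Ω := fun x hx => by
    by_contra h
    have h1 : t / 4 ≤ d x := hsub hx
    have h2 : d x = 0 := Metric.infDist_zero_of_mem h
    linarith
  refine ⟨χ, ⟨hχs, ?_, hsubΩ⟩, hχ0, hχ1, fun x => ?_, hone⟩
  · exact Metric.isCompact_of_isClosed_isBounded (isClosed_tsupport _) (hΩ.subset hsubΩ)
  · rw [norm_gradient]
    exact norm_fderiv_le_of_lipschitz ℝ hχL

end Cutoff

/-! ### Products of L²-convergent sequences. -/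

section SmulConvergence

variable {α F : Type*} [MeasurableSpace α] {μ : Measure α} [NormedAddCommGroup F] [NormedSpace ℝ F]

lemma integrable_smul_of_memLp_two {a : α → ℝ} {b : α → F} (ha : MemLp a 2 μ) (hb : MemLp b 2 μ) :
    Integrable (fun x => a x • b x) μ :=
  memLp_one_iff_integrable.1 (hb.smul ha)

/-- Split ab - a'b' = (a - a')(b - b') + (a - a')b' + a'(b - b') and apply Hölder's inequality to
each term. -/
lemma tendsto_integral_smul {a : ℕ → α → ℝ} {a' : α → ℝ} {b : ℕ → α → F} {b' : α → F}
    (ha : ∀ k, MemLp (a k) 2 μ) (ha' : MemLp a' 2 μ) (hb : ∀ k, MemLp (b k) 2 μ)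
    (hb' : MemLp b' 2 μ)
    (hat : Tendsto (fun k => eLpNorm (fun x => a k x - a' x) 2 μ) atTop (𝓝 0))
    (hbt : Tendsto (fun k => eLpNorm (fun x => b k x - b' x) 2 μ) atTop (𝓝 0)) :
    Tendsto (fun k => ∫ x, a k x • b k x ∂μ) atTop (𝓝 (∫ x, a' x • b' x ∂μ)) := by
  refine tendsto_integral_of_L1' _ (integrable_smul_of_memLp_two ha' hb').1
    (Eventually.of_forall fun k => integrable_smul_of_memLp_two (ha k) (hb k)) ?_
  have hbound : ∀ k, eLpNorm ((fun x => a k x • b k x) - fun x => a' x • b' x) 1 μ ≤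
      eLpNorm (fun x => a k x - a' x) 2 μ * eLpNorm (fun x => b k x - b' x) 2 μ +
      eLpNorm (fun x => a k x - a' x) 2 μ * eLpNorm b' 2 μ +
      eLpNorm a' 2 μ * eLpNorm (fun x => b k x - b' x) 2 μ := fun k => by
    have e : ((fun x => a k x • b k x) - fun x => a' x • b' x) =
        ((fun x => a k x - a' x) • (fun x => b k x - b' x) + (fun x => a k x - a' x) • b') +
          a' • (fun x => b k x - b' x) := by
      ext x
      simp only [Pi.sub_apply, Pi.add_apply, Pi.smul_apply', sub_smul, smul_sub]
      abel
    have m1 := (ha k).sub ha'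
    have m2 := (hb k).sub hb'
    rw [e]
    refine (eLpNorm_add_le ?_ ?_ le_rfl).trans (add_le_add ((eLpNorm_add_le ?_ ?_ le_rfl).trans
      (add_le_add ?_ ?_)) ?_)
    · exact (m1.1.smul m2.1).add (m1.1.smul hb'.1)
    · exact ha'.1.smul m2.1
    · exact m1.1.smul m2.1
    · exact m1.1.smul hb'.1
    · exact eLpNorm_smul_le_mul_eLpNorm m2.1 m1.1
    · exact eLpNorm_smul_le_mul_eLpNorm hb'.1 m1.1
    · exact eLpNorm_smul_le_mul_eLpNorm m2.1 ha'.1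
  refine tendsto_of_tendsto_of_tendsto_of_le_of_le tendsto_const_nhds ?_ (fun _ => zero_le)
    hbound
  have h1 := ENNReal.Tendsto.mul hat (Or.inr ENNReal.zero_ne_top) hbt (Or.inr ENNReal.zero_ne_top)
  have h2 := ENNReal.Tendsto.mul_const (b := eLpNorm b' 2 μ) hat (Or.inr hb'.2.ne)
  have h3 := ENNReal.Tendsto.const_mul (a := eLpNorm a' 2 μ) hbt (Or.inr ha'.2.ne)
  simpa using (h1.add h2).add h3

end SmulConvergence

/-! ### Weak gradients: integration by parts, closedness, uniqueness. -/

section WeakGradient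

variable {n : ℕ} {Ω : Set (E n)}

lemma IsTestFunction.gradient_eq_zero {ψ : E n → ℝ} (hψ : IsTestFunction Ω ψ) {x : E n}
    (hx : x ∉ Ω) : gradient ψ x = 0 := by
  have : fderiv ℝ ψ x = 0 := by
    by_contra h
    exact hx (hψ.tsupport_subset (support_fderiv_subset ℝ h))
  simp [gradient, this]

lemma IsTestFunction.eq_zero {ψ : E n → ℝ} (hψ : IsTestFunction Ω ψ) {x : E n}
    (hx : x ∉ Ω) : ψ x = 0 := by
  by_contra h
  exact hx (hψ.tsupport_subset (subset_tsupport _ h))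

lemma IsTestFunction.hasCompactSupport_gradient {ψ : E n → ℝ} (hψ : IsTestFunction Ω ψ) :
    HasCompactSupport (gradient ψ) :=
  (hψ.hasCompactSupport.fderiv (𝕜 := ℝ)).comp_left (map_zero _)

lemma IsTestFunction.memLp {ψ : E n → ℝ} (hψ : IsTestFunction Ω ψ) (p : ℝ≥0∞) (μ : Measure (E n))
    [IsFiniteMeasureOnCompacts μ] : MemLp ψ p μ :=
  hψ.contDiff.continuous.memLp_of_hasCompactSupport hψ.hasCompactSupport

lemma IsTestFunction.memLp_gradient {ψ : E n → ℝ} (hψ : IsTestFunction Ω ψ) (p : ℝ≥0∞)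
    (μ : Measure (E n)) [IsFiniteMeasureOnCompacts μ] : MemLp (gradient ψ) p μ :=
  (continuous_gradient hψ.contDiff).memLp_of_hasCompactSupport hψ.hasCompactSupport_gradient

lemma memLp_of_continuous_of_isBounded {F : Type*} [NormedAddCommGroup F]
    (hΩ : Bornology.IsBounded Ω) {f : E n → F}
    (hf : Continuous f) (p : ℝ≥0∞) : MemLp f p (volume.restrict Ω) := by
  have hK : IsCompact (closure Ω) := hΩ.isCompact_closure
  obtain ⟨C, hC⟩ := hK.exists_bound_of_continuousOn hf.continuousOn
  have : IsFiniteMeasure (volume.restrict (closure Ω)) :=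
    ⟨by simpa using hK.measure_lt_top⟩
  refine MemLp.mono_measure (Measure.restrict_mono subset_closure le_rfl) ?_
  refine MemLp.of_bound hf.aestronglyMeasurable C ?_
  exact (ae_restrict_iff' isClosed_closure.measurableSet).2 (Eventually.of_forall hC)

/-- Since ψ vanishes outside Ω, both integrals extend to the whole space; pairing with a fixed
vector reduces to scalar integration by parts, and no boundary term appears. -/
lemma integral_smul_gradient {ζ ψ : E n → ℝ} (hζ : ContDiff ℝ ∞ ζ) (hψ : IsTestFunction Ω ψ) :
    ∫ x in Ω, ζ x • gradient ψ x = -∫ x in Ω, ψ x • gradient ζ x := by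
  rw [setIntegral_eq_integral_of_forall_compl_eq_zero fun x hx => by
      rw [hψ.gradient_eq_zero hx, smul_zero],
    setIntegral_eq_integral_of_forall_compl_eq_zero fun x hx => by
      rw [hψ.eq_zero hx, zero_smul]]
  have c1 := hζ.continuous
  have c2 := hψ.contDiff.continuous
  have c3 := continuous_gradient hζ
  have c4 := continuous_gradient hψ.contDiff
  have i1 : Integrable fun x => ζ x • gradient ψ x :=
    (c1.smul c4).integrable_of_hasCompactSupport hψ.hasCompactSupport_gradient.smul_left
  have i2 : Integrable fun x => ψ x • gradient ζ x :=
    (c2.smul c3).integrable_of_hasCompactSupport hψ.hasCompactSupport.smul_right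
  refine ext_inner_left ℝ fun v => ?_
  rw [inner_neg_right, ← integral_inner i1, ← integral_inner i2]
  have e1 : ∀ x, inner ℝ v (ζ x • gradient ψ x) = ζ x * fderiv ℝ ψ x v := fun x => by
    rw [inner_smul_right, real_inner_comm, inner_gradient]
  have e2 : ∀ x, inner ℝ v (ψ x • gradient ζ x) = fderiv ℝ ζ x v * ψ x := fun x => by
    rw [inner_smul_right, real_inner_comm, inner_gradient, mul_comm]
  have j1 := i1.const_inner (𝕜 := ℝ) v
  have j2 := i2.const_inner (𝕜 := ℝ) v
  simp only [e1, e2] at j1 j2 ⊢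
  refine integral_mul_fderiv_eq_neg_fderiv_mul_of_integrable j2 j1 ?_
    (fun x _ => (hζ.differentiable (by simp)) x)
    (fun x _ => (hψ.contDiff.differentiable (by simp)) x)
  exact (c1.mul c2).integrable_of_hasCompactSupport hψ.hasCompactSupport.mul_left

/-- The weak gradient is closed under `H¹` limits of smooth functions. -/
lemma TendstoH1.hasWeakGradient (hΩ : Bornology.IsBounded Ω) {ζ : ℕ → E n → ℝ} {u : L2 Ω}
    {g : L2Vec Ω} (hζ : ∀ k, ContDiff ℝ ∞ (ζ k)) (h : TendstoH1 Ω ζ u g) :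
    HasWeakGradient Ω u g := by
  intro ψ hψ
  have mζ := fun k => memLp_of_continuous_of_isBounded hΩ (hζ k).continuous 2
  have mg := fun k => memLp_of_continuous_of_isBounded hΩ (continuous_gradient (hζ k)) 2
  have t1 := tendsto_integral_smul mζ (Lp.memLp u) (fun _ => hψ.memLp_gradient 2 _)
    (hψ.memLp_gradient 2 _) h.1 (by simp)
  have t2 := tendsto_integral_smul (fun _ => hψ.memLp 2 _) (hψ.memLp 2 _) mg (Lp.memLp g)
    (by simp) h.2
  simp only [integral_smul_gradient (hζ _) hψ] at t1
  exact tendsto_nhds_unique t1 t2.neg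

/-- The fundamental lemma of the calculus of variations, applied to the difference. It identifies
the gradient in the weak equation with the one in the definition of the trace. -/
lemma HasWeakGradient.unique (hΩ : IsOpen Ω) {u : L2 Ω} {g g' : L2Vec Ω}
    (h : HasWeakGradient Ω u g) (h' : HasWeakGradient Ω u g') : g = g' := by
  have hz := hΩ.ae_eq_zero_of_integral_contDiff_smul_eq_zero (μ := volume.restrict Ω)
    (f := fun x => g x - g' x)
    ((((Lp.memLp g).sub (Lp.memLp g')).locallyIntegrable (by norm_num)).locallyIntegrableOn _) ?_
  · refine Lp.ext ?_
    filter_upwards [hz, ae_restrict_mem hΩ.measurableSet] with x hx hxΩ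
    exact sub_eq_zero.1 (hx hxΩ)
  · intro ψ h1 h2 h3
    have hψ : IsTestFunction Ω ψ := ⟨h1, h2, h3⟩
    have e := (h ψ hψ).symm.trans (h' ψ hψ)
    simp only [smul_sub]
    rw [integral_sub (integrable_smul_of_memLp_two (hψ.memLp 2 _) (Lp.memLp g))
      (integrable_smul_of_memLp_two (hψ.memLp 2 _) (Lp.memLp g')), sub_eq_zero]
    exact neg_injective e

end WeakGradient

/-! ### Poincaré's inequality. -/

section Poincare

variable {n : ℕ} {Ω : Set (E n)}

lemma lintegral_enorm_sq_eq_ofReal {F : Type*} [NormedAddCommGroup F] {f : E n → F}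
    (hf : MemLp f 2 volume) :
    ∫⁻ x, ‖f x‖ₑ ^ 2 = ENNReal.ofReal (∫ x, ‖f x‖ ^ 2) := by
  have hi : Integrable (fun x => ‖f x‖ ^ 2) := by simpa using hf.integrable_norm_pow (by norm_num)
  rw [ofReal_integral_eq_lintegral_ofReal hi (Eventually.of_forall fun x => by positivity)]
  simp [ENNReal.ofReal_pow]

/-- Integrate by parts against the first coordinate p, whose derivative along e is 1: ∫ψ² = -∫ 2pψ
∂ₑψ. As |p| ≤ R on Ω, Young's inequality bounds this by ½∫ψ² + 2R²∫|∇ψ|², and the first term is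
absorbed. -/
lemma IsTestFunction.integral_sq_le (hn : 1 ≤ n) {R : ℝ}
    (hR : Ω ⊆ Metric.closedBall 0 R) {ψ : E n → ℝ} (hψ : IsTestFunction Ω ψ) :
    ∫ x, ‖ψ x‖ ^ 2 ≤ (2 * R) ^ 2 * ∫ x, ‖gradient ψ x‖ ^ 2 := by
  obtain ⟨e, p, he, hp, hpe⟩ : ∃ (e : E n) (p : E n →L[ℝ] ℝ), ‖e‖ = 1 ∧ (∀ x, |p x| ≤ ‖x‖) ∧
      p e = 1 :=
    ⟨EuclideanSpace.single ⟨0, hn⟩ 1, EuclideanSpace.proj ⟨0, hn⟩, by simp,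
      fun x => by simpa using PiLp.norm_apply_le x ⟨0, hn⟩, by simp⟩
  have c1 := hψ.contDiff.continuous
  have c2 := continuous_gradient hψ.contDiff
  have dψ : Differentiable ℝ ψ := hψ.contDiff.differentiable (by simp)
  have i1 : Integrable fun x => ‖ψ x‖ ^ 2 := by
    simpa using (hψ.memLp 2 volume).integrable_norm_pow two_ne_zero
  have i2 : Integrable fun x => ‖gradient ψ x‖ ^ 2 := by
    simpa using (hψ.memLp_gradient 2 volume).integrable_norm_pow two_ne_zero
  have dsq : ∀ x, fderiv ℝ (fun y => ψ y * ψ y) x e = 2 * ψ x * fderiv ℝ ψ x e := fun x => by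
    rw [fderiv_fun_mul (dψ x) (dψ x)]
    simp; ring
  have cfd : Continuous fun x => fderiv ℝ ψ x e := by
    simp only [← inner_gradient]; fun_prop
  have iprod : Integrable fun x => p x * (2 * ψ x * fderiv ℝ ψ x e) :=
    (p.continuous.mul ((continuous_const.mul c1).mul cfd)).integrable_of_hasCompactSupport
      (HasCompactSupport.mul_left (HasCompactSupport.mul_right
        (HasCompactSupport.mul_left hψ.hasCompactSupport)))
  have parts : ∫ x, p x * fderiv ℝ (fun y => ψ y * ψ y) x e =
      -∫ x, fderiv ℝ p x e * (ψ x * ψ x) := by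
    have hs : HasCompactSupport fun x => ψ x * ψ x := hψ.hasCompactSupport.mul_left
    refine integral_mul_fderiv_eq_neg_fderiv_mul_of_integrable ?_ ?_ ?_
      (fun x _ => p.differentiableAt) (fun x _ => (dψ x).mul (dψ x))
    · simp only [p.fderiv]
      exact (continuous_const.mul (c1.mul c1)).integrable_of_hasCompactSupport hs.mul_left
    · simp only [dsq]
      exact iprod
    · exact (p.continuous.mul (c1.mul c1)).integrable_of_hasCompactSupport hs.mul_left
  simp only [p.fderiv, hpe, one_mul, dsq] at parts
  have key : ∫ x, ‖ψ x‖ ^ 2 ≤ ∫ x, (1 / 2 * ‖ψ x‖ ^ 2 + 2 * R ^ 2 * ‖gradient ψ x‖ ^ 2) := by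
    have e1 : ∫ x, ‖ψ x‖ ^ 2 = ∫ x, -(p x * (2 * ψ x * fderiv ℝ ψ x e)) := by
      rw [integral_neg, parts, neg_neg]
      simp [sq]
    rw [e1]
    refine integral_mono iprod.neg ((i1.const_mul _).add (i2.const_mul _)) fun x => ?_
    show -(p x * (2 * ψ x * fderiv ℝ ψ x e)) ≤ 1 / 2 * ‖ψ x‖ ^ 2 + 2 * R ^ 2 * ‖gradient ψ x‖ ^ 2
    by_cases hx : x ∈ Ω
    · have hpx : |p x| ≤ R := (hp x).trans (by simpa using hR hx)
      have hd : |fderiv ℝ ψ x e| ≤ ‖gradient ψ x‖ := by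
        rw [← inner_gradient]
        simpa [he] using abs_real_inner_le_norm (gradient ψ x) e
      have hprod : (p x * fderiv ℝ ψ x e) ^ 2 ≤ R ^ 2 * ‖gradient ψ x‖ ^ 2 := by
        have hR0 : 0 ≤ R := (abs_nonneg _).trans hpx
        rw [← mul_pow, ← sq_abs, abs_mul]
        gcongr
      rw [Real.norm_eq_abs, sq_abs]
      nlinarith [sq_nonneg (ψ x + 2 * (p x * fderiv ℝ ψ x e))]
    · rw [hψ.eq_zero hx]
      simp only [mul_zero, zero_mul, neg_zero]
      positivity
  rw [integral_add (i1.const_mul _) (i2.const_mul _), integral_const_mul, integral_const_mul] at key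
  have e2 : (2 * R) ^ 2 * ∫ x, ‖gradient ψ x‖ ^ 2 = 2 * (2 * R ^ 2 * ∫ x, ‖gradient ψ x‖ ^ 2) := by
    ring
  linarith

/-- The Poincaré inequality for test functions. -/
lemma exists_poincare (hn : 1 ≤ n) (hΩ : Bornology.IsBounded Ω) :
    ∃ C : ℝ≥0, ∀ ψ : E n → ℝ, IsTestFunction Ω ψ →
      eLpNorm ψ 2 (volume.restrict Ω) ≤ C * eLpNorm (gradient ψ) 2 (volume.restrict Ω) := by
  obtain ⟨R, hR0, hR⟩ := hΩ.subset_closedBall_lt 0 0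
  refine ⟨(2 * R).toNNReal, fun ψ hψ => ?_⟩
  rw [eLpNorm_restrict_eq_of_support_subset fun x hx => by_contra fun h => hx (hψ.eq_zero h),
    eLpNorm_restrict_eq_of_support_subset fun x hx =>
      by_contra fun h => hx (hψ.gradient_eq_zero h)]
  refine (ENNReal.pow_le_pow_left_iff two_ne_zero).1 ?_
  rw [mul_pow, eLpNorm_two_sq, eLpNorm_two_sq, lintegral_enorm_sq_eq_ofReal (hψ.memLp 2 _),
    lintegral_enorm_sq_eq_ofReal (hψ.memLp_gradient 2 _), ← ENNReal.ofReal.eq_1,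
    ← ENNReal.ofReal_pow (by positivity), ← ENNReal.ofReal_mul (by positivity)]
  exact ENNReal.ofReal_le_ofReal (hψ.integral_sq_le hn hR)

lemma tendsto_toLp_iff {α F : Type*} [MeasurableSpace α] {μ : Measure α} [NormedAddCommGroup F]
    {f : ℕ → α → F} (hf : ∀ k, MemLp (f k) 2 μ) (u : Lp F 2 μ) :
    Tendsto (fun k => (hf k).toLp (f k)) atTop (𝓝 u) ↔
      Tendsto (fun k => eLpNorm (fun x => f k x - u x) 2 μ) atTop (𝓝 0) := by
  have := Lp.tendsto_Lp_iff_tendsto_eLpNorm'' (fi := atTop) f hf u (Lp.memLp u)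
  rwa [Lp.toLp_coeFn] at this

lemma MemH10.norm_le {C : ℝ≥0} (hC : ∀ ψ : E n → ℝ, IsTestFunction Ω ψ →
      eLpNorm ψ 2 (volume.restrict Ω) ≤ C * eLpNorm (gradient ψ) 2 (volume.restrict Ω))
    {ψ : L2 Ω} {h : L2Vec Ω} (hψ : MemH10 Ω ψ h) : ‖ψ‖ ≤ C * ‖h‖ := by
  obtain ⟨-, ζ, hζ, hζ1, hζ2⟩ := hψ
  have e1 := (tendsto_toLp_iff (fun k => (hζ k).memLp 2 _) ψ).2 hζ1
  have e2 := (tendsto_toLp_iff (fun k => (hζ k).memLp_gradient 2 _) h).2 hζ2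
  refine le_of_tendsto_of_tendsto' e1.norm (e2.norm.const_mul _) fun k => ?_
  rw [Lp.norm_toLp, Lp.norm_toLp, ← ENNReal.coe_toReal, ← ENNReal.toReal_mul]
  exact ENNReal.toReal_mono
    (ENNReal.mul_ne_top ENNReal.coe_ne_top ((hζ k).memLp_gradient 2 _).2.ne) (hC _ (hζ k))

end Poincare

/-! ### H₀¹ as a Hilbert space and Lax–Milgram. -/

section LaxMilgram

variable {n : ℕ} {Ω : Set (E n)}

lemma IsTestFunction.add {ψ χ : E n → ℝ} (hψ : IsTestFunction Ω ψ) (hχ : IsTestFunction Ω χ) :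
    IsTestFunction Ω (fun x => ψ x + χ x) where
  contDiff := hψ.contDiff.add hχ.contDiff
  hasCompactSupport := hψ.hasCompactSupport.add hχ.hasCompactSupport
  tsupport_subset := (tsupport_add ψ χ).trans
    (union_subset hψ.tsupport_subset hχ.tsupport_subset)

lemma IsTestFunction.const_mul {ψ : E n → ℝ} (c : ℝ) (hψ : IsTestFunction Ω ψ) :
    IsTestFunction Ω (fun x => c * ψ x) where
  contDiff := contDiff_const.mul hψ.contDiff
  hasCompactSupport := hψ.hasCompactSupport.mul_left
  tsupport_subset := tsupport_mul_subset_right.trans hψ.tsupport_subset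

lemma IsTestFunction.zero : IsTestFunction Ω (fun _ => 0) where
  contDiff := contDiff_const
  hasCompactSupport := HasCompactSupport.zero
  tsupport_subset := by simp [tsupport]

/-- Pairs of a test function and its gradient, as a subspace of `L² × L²`. -/
def testPairs (Ω : Set (E n)) : Submodule ℝ (WithLp 2 (L2 Ω × L2Vec Ω)) where
  carrier := {p | ∃ ψ : E n → ℝ, IsTestFunction Ω ψ ∧ p.fst =ᵐ[volume.restrict Ω] ψ ∧
    p.snd =ᵐ[volume.restrict Ω] gradient ψ}
  add_mem' := by
    rintro p p' ⟨ψ, hψ, h1, h2⟩ ⟨ψ', hψ', h1', h2'⟩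
    refine ⟨_, hψ.add hψ', ?_, ?_⟩
    · filter_upwards [h1, h1', Lp.coeFn_add p.fst p'.fst] with x e e' e''
      exact e''.trans (congrArg₂ (· + ·) e e')
    · filter_upwards [h2, h2', Lp.coeFn_add p.snd p'.snd] with x e e' e''
      rw [gradient_add (hψ.contDiff.differentiable (by simp) x)
        (hψ'.contDiff.differentiable (by simp) x)]
      exact e''.trans (congrArg₂ (· + ·) e e')
  zero_mem' := by
    refine ⟨_, IsTestFunction.zero, ?_, ?_⟩
    · exact Lp.coeFn_zero _ _ _
    · filter_upwards [Lp.coeFn_zero (E n) 2 (volume.restrict Ω)] with x e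
      exact e.trans (by simp [gradient])
  smul_mem' := by
    rintro c p ⟨ψ, hψ, h1, h2⟩
    refine ⟨_, hψ.const_mul c, ?_, ?_⟩
    · filter_upwards [h1, Lp.coeFn_smul c p.fst] with x e e''
      exact e''.trans (congrArg (c • ·) e)
    · filter_upwards [h2, Lp.coeFn_smul c p.snd] with x e e''
      rw [gradient_const_mul c (hψ.contDiff.differentiable (by simp) x)]
      exact e''.trans (congrArg (c • ·) e)

/-- This exhibits H₀¹ as a closed subspace of L² × L², hence as a Hilbert space. The weak gradient
condition in `MemH10` is automatic for limits, by `TendstoH1.hasWeakGradient`. -/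
lemma memH10_iff (hΩ : Bornology.IsBounded Ω) {ψ : L2 Ω} {h : L2Vec Ω} :
    MemH10 Ω ψ h ↔ WithLp.toLp 2 (ψ, h) ∈ (testPairs Ω).topologicalClosure := by
  rw [← SetLike.mem_coe, Submodule.topologicalClosure_coe, mem_closure_iff_seq_limit]
  constructor
  · rintro ⟨-, ζ, hζ, hζ1, hζ2⟩
    have e1 := (tendsto_toLp_iff (fun k => (hζ k).memLp 2 _) ψ).2 hζ1
    have e2 := (tendsto_toLp_iff (fun k => (hζ k).memLp_gradient 2 _) h).2 hζ2
    refine ⟨fun k => WithLp.toLp 2 (((hζ k).memLp 2 _).toLp _, ((hζ k).memLp_gradient 2 _).toLp _),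
      fun k => ⟨ζ k, hζ k, ((hζ k).memLp 2 _).coeFn_toLp,
        ((hζ k).memLp_gradient 2 _).coeFn_toLp⟩, ?_⟩
    exact ((WithLp.prod_continuous_toLp 2 _ _).tendsto _).comp (e1.prodMk_nhds e2)
  · rintro ⟨p, hp, hlim⟩
    choose ζ hζ h1 h2 using hp
    have t := ((WithLp.prod_continuous_ofLp 2 _ _).tendsto _).comp hlim
    have t1 := (continuous_fst.tendsto _).comp t
    have t2 := (continuous_snd.tendsto _).comp t
    have H : TendstoH1 Ω ζ ψ h := by
      constructor
      · rw [← tendsto_toLp_iff (fun k => (hζ k).memLp 2 _) ψ]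
        refine t1.congr fun k => Lp.ext ((h1 k).trans (MemLp.coeFn_toLp _).symm)
      · rw [← tendsto_toLp_iff (fun k => (hζ k).memLp_gradient 2 _) h]
        refine t2.congr fun k => Lp.ext ((h2 k).trans (MemLp.coeFn_toLp _).symm)
    exact ⟨H.hasWeakGradient hΩ fun k => (hζ k).contDiff, ζ, hζ, H⟩

/-- Multiplication by an essentially bounded function, as an operator on `L²`. -/
def mulL2 {α : Type*} [MeasurableSpace α] (μ : Measure α) (a : Lp ℝ ∞ μ) :
    Lp ℝ 2 μ →L[ℝ] Lp ℝ 2 μ :=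
  (ContinuousLinearMap.lsmul ℝ ℝ).holderL μ ∞ 2 2 a

lemma inner_mulL2 {α : Type*} [MeasurableSpace α] {μ : Measure α} {b : α → ℝ} (hb : MemLp b ∞ μ)
    (z ψ : Lp ℝ 2 μ) : inner ℝ (mulL2 μ (hb.toLp b) z) ψ = ∫ x, b x * z x * ψ x ∂μ := by
  rw [L2.inner_def]
  refine integral_congr_ae ?_
  filter_upwards [(ContinuousLinearMap.lsmul ℝ ℝ).coeFn_holder (r := 2) (hb.toLp b) z,
    hb.coeFn_toLp] with x e1 e2
  change inner ℝ
    ((ContinuousLinearMap.holder 2 (ContinuousLinearMap.lsmul ℝ ℝ) (hb.toLp b) z) x) (ψ x) = _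
  rw [e1, e2]
  simp [mul_comm]

/-- The bilinear form of `-Δ + b` on `H₀¹`. -/
def dirichletForm (Ω : Set (E n)) (a : Lp ℝ ∞ (volume.restrict Ω))
    (V : Submodule ℝ (WithLp 2 (L2 Ω × L2Vec Ω))) : V →L[ℝ] V →L[ℝ] ℝ :=
  let f : V →L[ℝ] L2 Ω := (WithLp.fstL 2 ℝ (L2 Ω) (L2Vec Ω)).comp V.subtypeL
  let s : V →L[ℝ] L2Vec Ω := (WithLp.sndL 2 ℝ (L2 Ω) (L2Vec Ω)).comp V.subtypeL
  (isBoundedBilinearMap_inner (𝕜 := ℝ) (E := L2Vec Ω)).toContinuousLinearMap.bilinearComp s s +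
  (isBoundedBilinearMap_inner (𝕜 := ℝ) (E := L2 Ω)).toContinuousLinearMap.bilinearComp
    ((mulL2 _ a).comp f) f

lemma dirichletForm_apply (a : Lp ℝ ∞ (volume.restrict Ω))
    (V : Submodule ℝ (WithLp 2 (L2 Ω × L2Vec Ω))) (p p' : V) :
    dirichletForm Ω a V p p' = inner ℝ p.1.snd p'.1.snd + inner ℝ (mulL2 _ a p.1.fst) p'.1.fst :=
  rfl

/-- Lax–Milgram for the Dirichlet problem with homogeneous boundary values that is obtained by
subtracting `u₀` from the solution. -/
lemma exists_correction (hn : 1 ≤ n) (hΩ : Bornology.IsBounded Ω) {b : E n → ℝ}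
    (hb : MemLp b ∞ (volume.restrict Ω)) (hb0 : ∀ᵐ x ∂volume.restrict Ω, 0 ≤ b x)
    (u₀ : L2 Ω) (g₀ : L2Vec Ω) :
    ∃ (w : L2 Ω) (k : L2Vec Ω), MemH10 Ω w k ∧ ∀ (ψ : L2 Ω) (h : L2Vec Ω), MemH10 Ω ψ h →
      (∫ x in Ω, inner ℝ ((g₀ + k) x) (h x)) + ∫ x in Ω, b x * (u₀ + w) x * ψ x = 0 := by
  obtain ⟨C, hC⟩ := exists_poincare hn hΩ
  let V := (testPairs Ω).topologicalClosure
  have : CompleteSpace V := (testPairs Ω).isClosed_topologicalClosure.completeSpace_coe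
  let a := hb.toLp b
  let B := dirichletForm Ω a V
  have hV : ∀ p : V, MemH10 Ω p.1.fst p.1.snd := fun p => (memH10_iff hΩ).2 p.2
  have hB : IsCoercive B := by
    -- By Poincaré, ‖ψ‖² + ‖∇ψ‖² ≤ (1 + C²)‖∇ψ‖², and the zeroth-order term is nonnegative.
    refine ⟨(1 + (C : ℝ) ^ 2)⁻¹, by positivity, fun p => ?_⟩
    rw [dirichletForm_apply, inner_mulL2 hb, real_inner_self_eq_norm_sq]
    have h1 := (hV p).norm_le hC
    have h2 : 0 ≤ ∫ x in Ω, b x * p.1.fst x * p.1.fst x := by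
      refine integral_nonneg_of_ae ?_
      filter_upwards [hb0] with x hx
      rw [mul_assoc]
      exact mul_nonneg hx (mul_self_nonneg _)
    have h3 : ‖p‖ * ‖p‖ = ‖p.1.fst‖ ^ 2 + ‖p.1.snd‖ ^ 2 := by
      rw [← sq]
      exact WithLp.prod_norm_sq_eq_of_L2 p.1
    rw [mul_assoc, h3, inv_mul_le_iff₀ (by positivity)]
    have h4 : ‖p.1.fst‖ ^ 2 ≤ C ^ 2 * ‖p.1.snd‖ ^ 2 := by rw [← mul_pow]; gcongr
    have h5 : 0 ≤ (1 + (C : ℝ) ^ 2) * ∫ x in Ω, b x * p.1.fst x * p.1.fst x := by positivity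
    linarith
  -- Minus the contribution of u₀ to the weak equation, moved to the right-hand side.
  let ℓ : StrongDual ℝ V :=
    -((innerSL ℝ g₀).comp ((WithLp.sndL 2 ℝ (L2 Ω) (L2Vec Ω)).comp V.subtypeL) +
    (innerSL ℝ (mulL2 _ a u₀)).comp ((WithLp.fstL 2 ℝ (L2 Ω) (L2Vec Ω)).comp V.subtypeL))
  let w : V := hB.continuousLinearEquivOfBilin.symm ((InnerProductSpace.toDual ℝ V).symm ℓ)
  have hw : ∀ p, B w p = ℓ p := fun p => by
    rw [← hB.continuousLinearEquivOfBilin_apply, ContinuousLinearEquiv.apply_symm_apply,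
      InnerProductSpace.toDual_symm_apply]
  refine ⟨w.1.fst, w.1.snd, hV w, fun ψ h hψ => ?_⟩
  have e := hw ⟨_, (memH10_iff hΩ).1 hψ⟩
  rw [dirichletForm_apply] at e
  change inner ℝ w.1.snd h + inner ℝ (mulL2 _ a w.1.fst) ψ =
    -(inner ℝ g₀ h + inner ℝ (mulL2 _ a u₀) ψ) at e
  rw [← inner_mulL2 hb, ← L2.inner_def, map_add, inner_add_left, inner_add_left]
  linarith

end LaxMilgram

/-! ### One-dimensional estimates. -/

section OneDim

lemma ennreal_add_sq_le (a b : ℝ≥0∞) : (a + b) ^ 2 ≤ 4 * a ^ 2 + 4 * b ^ 2 := by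
  rcases le_total a b with h | h
  · calc (a + b) ^ 2 ≤ (b + b) ^ 2 := by gcongr
      _ = 4 * b ^ 2 := by ring
      _ ≤ _ := le_add_self
  · calc (a + b) ^ 2 ≤ (a + a) ^ 2 := by gcongr
      _ = 4 * a ^ 2 := by ring
      _ ≤ _ := le_self_add

lemma lintegral_enorm_sq_le {α F : Type*} [MeasurableSpace α] [NormedAddCommGroup F] {μ : Measure α}
    {f : α → F} (hf : AEStronglyMeasurable f μ) :
    (∫⁻ x, ‖f x‖ₑ ∂μ) ^ 2 ≤ μ univ * ∫⁻ x, ‖f x‖ₑ ^ 2 ∂μ := by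
  have h := eLpNorm_le_eLpNorm_mul_rpow_measure_univ (p := 1) (q := 2) (by norm_num) hf
  rw [eLpNorm_one_eq_lintegral_enorm] at h
  refine (pow_le_pow_left' h 2).trans_eq ?_
  rw [mul_pow, eLpNorm_two_sq, mul_comm, ← ENNReal.rpow_natCast, ← ENNReal.rpow_mul]
  norm_num

/-- The fundamental theorem of calculus from 0, then Cauchy–Schwarz on (0, T). It will be used on
vertical segments starting at the boundary. -/
lemma enorm_sq_le_add_lintegral_deriv {f f' : ℝ → ℝ} (hf : ∀ s, HasDerivAt f (f' s) s)
    (hc : Continuous f') {s T : ℝ} (hs : s ∈ Ioo 0 T) :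
    ‖f s‖ₑ ^ 2 ≤ 4 * ‖f 0‖ₑ ^ 2 + 4 * (ENNReal.ofReal T * ∫⁻ τ in Ioo 0 T, ‖f' τ‖ₑ ^ 2) := by
  have e := intervalIntegral.integral_eq_sub_of_hasDerivAt (fun x _ => hf x)
    (hc.intervalIntegrable 0 s)
  have h1 : ‖f s - f 0‖ₑ ≤ ∫⁻ τ in Ioo 0 T, ‖f' τ‖ₑ := by
    rw [← e, intervalIntegral.integral_of_le hs.1.le]
    refine (enorm_integral_le_lintegral_enorm _).trans (lintegral_mono_set ?_)
    exact fun x hx => ⟨hx.1, hx.2.trans_lt hs.2⟩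
  have h2 := lintegral_enorm_sq_le (μ := volume.restrict (Ioo 0 T)) hc.aestronglyMeasurable
  simp only [Measure.restrict_apply_univ, Real.volume_Ioo, sub_zero] at h2
  calc ‖f s‖ₑ ^ 2 = ‖f 0 + (f s - f 0)‖ₑ ^ 2 := by congr 2; ring
    _ ≤ (‖f 0‖ₑ + ‖f s - f 0‖ₑ) ^ 2 := by gcongr; exact enorm_add_le _ _
    _ ≤ 4 * ‖f 0‖ₑ ^ 2 + 4 * ‖f s - f 0‖ₑ ^ 2 := ennreal_add_sq_le _ _
    _ ≤ _ := by gcongr; exact (pow_le_pow_left' h1 2).trans h2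

end OneDim

/-! ### Boundary charts and the strip estimate. -/

section Chart

variable {n : ℕ} {Ω : Set (E n)}

/-- The point at height `s` above the graph of `γ`, in the coordinates given by `A`. -/
def graphPoint (A : E n ≃ₗᵢ[ℝ] WithLp 2 (E (n - 1) × ℝ)) (γ : E (n - 1) → ℝ) (y : E (n - 1))
    (s : ℝ) : E n :=
  A.symm (WithLp.toLp 2 (y, γ y + s))

variable {A : E n ≃ₗᵢ[ℝ] WithLp 2 (E (n - 1) × ℝ)} {γ : E (n - 1) → ℝ}

lemma apply_graphPoint (y : E (n - 1)) (s : ℝ) :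
    A (graphPoint A γ y s) = WithLp.toLp 2 (y, γ y + s) := by
  simp [graphPoint]

lemma graphPoint_eq_add (y : E (n - 1)) (s : ℝ) :
    graphPoint A γ y s = graphPoint A γ y 0 + s • A.symm (WithLp.toLp 2 (0, 1)) := by
  apply A.injective
  rw [map_add, map_smul, apply_graphPoint, apply_graphPoint]
  simp [← WithLp.toLp_smul, ← WithLp.toLp_add]

lemma norm_vertical : ‖A.symm (WithLp.toLp 2 ((0 : E (n - 1)), (1 : ℝ)))‖ = 1 := by
  rw [LinearIsometryEquiv.norm_map, WithLp.prod_norm_eq_of_L2]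
  simp

lemma dist_graphPoint (y : E (n - 1)) (s : ℝ) :
    dist (graphPoint A γ y s) (graphPoint A γ y 0) = |s| := by
  rw [graphPoint_eq_add, dist_eq_norm, add_sub_cancel_left, norm_smul, norm_vertical, mul_one,
    Real.norm_eq_abs]

lemma continuous_graphPoint (hγ : Continuous γ) :
    Continuous fun p : E (n - 1) × ℝ => graphPoint A γ p.1 p.2 := by
  unfold graphPoint
  exact A.symm.continuous.comp ((WithLp.prod_continuous_toLp 2 _ _).comp (by fun_prop))

/-- The isometry preserves volume; after Fubini, the shift by γ(y) is a translation in the last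
variable. So flattening the boundary needs no Jacobian, even for merely continuous γ. -/
lemma lintegral_eq_lintegral_graphPoint {F : E n → ℝ≥0∞} (hF : Measurable F) :
    ∫⁻ x, F x = ∫⁻ y, ∫⁻ s, F (graphPoint A γ y s) := by
  have m1 := (A.symm.measurePreserving).comp (WithLp.volume_preserving_toLp (E (n - 1)) ℝ)
  rw [← m1.lintegral_comp hF, Measure.volume_eq_prod,
    lintegral_prod (fun p => F ((A.symm ∘ WithLp.toLp 2) p)) (hF.comp m1.measurable).aemeasurable]
  refine lintegral_congr fun y => ?_
  exact (lintegral_add_left_eq_self (fun s => F (A.symm (WithLp.toLp 2 (y, s)))) (γ y)).symm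

lemma hasDerivAt_graphPoint {ζ : E n → ℝ} (hζ : Differentiable ℝ ζ) (y : E (n - 1)) (s : ℝ) :
    HasDerivAt (fun τ => ζ (graphPoint A γ y τ))
      (fderiv ℝ ζ (graphPoint A γ y s) (A.symm (WithLp.toLp 2 (0, 1)))) s := by
  have h : HasDerivAt (fun τ => graphPoint A γ y τ) (A.symm (WithLp.toLp 2 (0, 1))) s := by
    rw [show (fun τ => graphPoint A γ y τ) = _ from funext (graphPoint_eq_add y)]
    simpa using ((hasDerivAt_id s).smul_const (A.symm (WithLp.toLp 2 (0, 1)))).const_add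
      (graphPoint A γ y 0)
  exact (hζ _).hasFDerivAt.comp_hasDerivAt s h

lemma enorm_sq_graphPoint_le (hγ : Continuous γ) {ζ : E n → ℝ} (hζ : ContDiff ℝ ∞ ζ)
    (y : E (n - 1)) {s T : ℝ} (hs : s ∈ Ioo 0 T) :
    ‖ζ (graphPoint A γ y s)‖ₑ ^ 2 ≤ 4 * ‖ζ (graphPoint A γ y 0)‖ₑ ^ 2 +
      4 * (ENNReal.ofReal T * ∫⁻ τ in Ioo 0 T, ‖gradient ζ (graphPoint A γ y τ)‖ₑ ^ 2) := by
  set e := A.symm (WithLp.toLp 2 ((0 : E (n - 1)), (1 : ℝ))) with he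
  have c : Continuous fun τ => graphPoint A γ y τ :=
    (continuous_graphPoint hγ).comp (by fun_prop : Continuous fun τ : ℝ => (y, τ))
  have c2 : Continuous fun τ => fderiv ℝ ζ (graphPoint A γ y τ) e := by
    simp only [← inner_gradient]
    exact ((continuous_gradient hζ).comp c).inner continuous_const
  refine (enorm_sq_le_add_lintegral_deriv
    (hasDerivAt_graphPoint (hζ.differentiable (by simp)) y) c2 hs).trans ?_
  gcongr with τ
  rw [← inner_gradient, enorm_le_iff_norm_le]
  have := norm_inner_le_norm (𝕜 := ℝ) (gradient ζ (graphPoint A γ y τ)) e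
  rwa [norm_vertical, mul_one] at this

/-- The graph of a function projects onto its domain by a `1`-Lipschitz map, so Lebesgue measure on
the domain is controlled by the surface measure. -/
lemma exists_lintegral_graph_le (hn : 1 ≤ n) : ∃ c : ℝ≥0, ∀ (Ω : Set (E n))
    (A : E n ≃ₗᵢ[ℝ] WithLp 2 (E (n - 1) × ℝ)) (γ : E (n - 1) → ℝ), Continuous γ →
    ∀ (D : Set (E (n - 1))), MeasurableSet D → (∀ y ∈ D, graphPoint A γ y 0 ∈ frontier Ω) →
    ∀ F : E n → ℝ≥0∞, Measurable F →
      ∫⁻ y in D, F (graphPoint A γ y 0) ≤ c * ∫⁻ x, F x ∂surfaceMeasure Ω := by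
  have hfin : Module.finrank ℝ (E (n - 1)) = n - 1 := by simp
  -- Lebesgue measure on the base is a constant multiple of this Haar measure, so the constant c
  -- depends only on n.
  have hhaar : (Measure.hausdorffMeasure ((n : ℝ) - 1) : Measure (E (n - 1))).IsAddHaarMeasure := by
    have := isAddHaarMeasure_hausdorffMeasure (E := E (n - 1))
    rwa [hfin, Nat.cast_sub hn, Nat.cast_one] at this
  let c := Measure.addHaarScalarFactor (volume : Measure (E (n - 1)))
    (Measure.hausdorffMeasure ((n : ℝ) - 1))
  have hc : (volume : Measure (E (n - 1))) = c • Measure.hausdorffMeasure ((n : ℝ) - 1) :=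
    Measure.isAddLeftInvariant_eq_smul _ _
  refine ⟨c, fun Ω A γ hγ D hD hDΩ F hF => ?_⟩
  have hm : Measurable fun y => graphPoint A γ y 0 :=
    ((continuous_graphPoint hγ).comp
      (by fun_prop : Continuous fun y : E (n - 1) => (y, (0 : ℝ)))).measurable
  have hle : (volume.restrict D).map (fun y => graphPoint A γ y 0) ≤ c • surfaceMeasure Ω := by
    refine Measure.le_iff.2 fun s hs => ?_
    rw [Measure.map_apply hm hs, Measure.restrict_apply (hm hs), Measure.smul_apply, surfaceMeasure,
      Measure.restrict_apply hs, hc, Measure.smul_apply]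
    refine smul_le_smul_of_nonneg_left ?_ zero_le
    have hP : LipschitzWith 1 fun x : E n => (A x).fst := by
      refine LipschitzWith.of_dist_le_mul fun x y => ?_
      rw [NNReal.coe_one, one_mul, ← A.dist_map x y]
      exact WithLp.dist_fst_le _ _
    have hH := hP.hausdorffMeasure_image_le (d := (n : ℝ) - 1)
      (sub_nonneg.2 (by exact_mod_cast hn)) (s ∩ frontier Ω)
    simp only [ENNReal.coe_one, ENNReal.one_rpow, one_mul] at hH
    refine (measure_mono ?_).trans hH
    rintro y ⟨hy, hyD⟩
    exact ⟨_, ⟨hy, hDΩ y hyD⟩, by simp [apply_graphPoint]⟩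
  rw [← lintegral_map hF hm]
  exact (lintegral_mono' hle le_rfl).trans_eq (lintegral_smul_measure _ _)

lemma IsBoundedLipschitzDomain.notMem_of_mem_frontier (hΩ : IsBoundedLipschitzDomain Ω) {x : E n}
    (hx : x ∈ frontier Ω) : x ∉ Ω := by
  rw [hΩ.isOpen.frontier_eq] at hx
  exact hx.2

/-- The `L²` norm in a strip along the part of the boundary covered by a chart. -/
lemma lintegral_strip_chart_le (hΩ : IsBoundedLipschitzDomain Ω) {x₀ : E n} {L : ℝ≥0} {r : ℝ}
    (hγ : LipschitzWith L γ)
    (hchart : ∀ y ∈ Metric.ball x₀ r, y ∈ Ω ↔ γ (A y).fst < (A y).snd) {c : ℝ≥0}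
    (hc : ∀ (D : Set (E (n - 1))), MeasurableSet D →
      (∀ y ∈ D, graphPoint A γ y 0 ∈ frontier Ω) → ∀ F : E n → ℝ≥0∞, Measurable F →
      ∫⁻ y in D, F (graphPoint A γ y 0) ≤ c * ∫⁻ x, F x ∂surfaceMeasure Ω)
    {t T : ℝ} (hTt : T = (1 + L) * t) (ht : 0 < t) (htr : t + T < r / 4) {ζ : E n → ℝ}
    (hζ : ContDiff ℝ ∞ ζ) :
    ∫⁻ x in Ω ∩ Metric.thickening t (Metric.ball x₀ (r / 2) ∩ frontier Ω), ‖ζ x‖ₑ ^ 2 ≤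
      ENNReal.ofReal T * (4 * (c * ∫⁻ x, ‖ζ x‖ₑ ^ 2 ∂surfaceMeasure Ω)) +
      ENNReal.ofReal T * (4 * (ENNReal.ofReal T *
        ∫⁻ x in Ω ∩ Metric.thickening T (frontier Ω), ‖gradient ζ x‖ₑ ^ 2)) := by
  have hT : 0 < T := by rw [hTt]; positivity
  set S := Ω ∩ Metric.thickening t (Metric.ball x₀ (r / 2) ∩ frontier Ω) with hS
  set U := Ω ∩ Metric.thickening T (frontier Ω) with hU
  have hSm : MeasurableSet S := (hΩ.isOpen.inter Metric.isOpen_thickening).measurableSet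
  have hUm : MeasurableSet U := (hΩ.isOpen.inter Metric.isOpen_thickening).measurableSet
  -- Since t + T < r/4, points of S have their foot in this smaller ball, while vertical segments of
  -- length T above D stay in the chart ball of radius r.
  set D : Set (E (n - 1)) := {y | graphPoint A γ y 0 ∈ Metric.ball x₀ (3 * r / 4)} with hD
  have hc0 : Continuous fun y => graphPoint A γ y 0 :=
    (continuous_graphPoint hγ.continuous).comp
      (by fun_prop : Continuous fun y : E (n - 1) => (y, (0 : ℝ)))
  have hDm : MeasurableSet D := (Metric.isOpen_ball.preimage hc0).measurableSet
  -- A point of S is within t of a boundary point p lying on or below the graph. The vertical offset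
  -- costs t and the change of γ between the two base points costs Lt, so the height is below (1 +
  -- L)t = T.
  have hS1 : ∀ y s, graphPoint A γ y s ∈ S → y ∈ D ∧ s ∈ Ioo 0 T := by
    rintro y s ⟨hx, hx'⟩
    obtain ⟨p, ⟨hp, hpΩ⟩, hxp⟩ := Metric.mem_thickening_iff.1 hx'
    have hxball : graphPoint A γ y s ∈ Metric.ball x₀ (r / 2 + t) := by
      have := dist_triangle (graphPoint A γ y s) p x₀
      rw [Metric.mem_ball] at hp ⊢
      linarith
    have hs0 : 0 < s := by
      have := (hchart _ (Metric.ball_subset_ball (by linarith) hxball)).1 hx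
      rw [apply_graphPoint] at this
      change γ y < γ y + s at this
      linarith
    have hpn : (A p).snd ≤ γ (A p).fst := by
      by_contra h
      exact hΩ.notMem_of_mem_frontier hpΩ
        ((hchart p (Metric.ball_subset_ball (by linarith) hp)).2 (not_le.1 h))
    have hd1 : dist y (A p).fst < t := by
      have := WithLp.dist_fst_le (A (graphPoint A γ y s)) (A p)
      rw [A.dist_map, apply_graphPoint] at this
      exact this.trans_lt hxp
    have hd2 : dist (γ y + s) (A p).snd < t := by
      have := WithLp.dist_snd_le (A (graphPoint A γ y s)) (A p)
      rw [A.dist_map, apply_graphPoint] at this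
      exact this.trans_lt hxp
    have hsT : s < T := by
      have h1 := (abs_lt.1 ((Real.dist_eq _ _).symm.trans_lt hd2)).2
      have h2 := (abs_le.1 ((Real.dist_eq _ _).symm.trans_le (hγ.dist_le_mul y (A p).fst))).1
      have h3 : L * dist y (A p).fst ≤ L * t := by gcongr
      rw [hTt]
      linarith
    refine ⟨?_, hs0, hsT⟩
    have h1 := dist_graphPoint (A := A) (γ := γ) y s
    have h2 := dist_triangle (graphPoint A γ y 0) (graphPoint A γ y s) x₀
    rw [dist_comm, abs_of_pos hs0] at h1
    rw [Metric.mem_ball] at hxball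
    simp only [hD, mem_ofPred_eq, Metric.mem_ball]
    linarith
  have hDball : ∀ y ∈ D, ∀ τ, 0 ≤ τ → τ < T → graphPoint A γ y τ ∈ Metric.ball x₀ r := by
    intro y hy τ h0 hτ
    have h1 := dist_graphPoint (A := A) (γ := γ) y τ
    have h2 := dist_triangle (graphPoint A γ y τ) (graphPoint A γ y 0) x₀
    simp only [hD, mem_ofPred_eq, Metric.mem_ball] at hy ⊢
    rw [abs_of_nonneg h0] at h1
    linarith
  have hDin : ∀ y ∈ D, ∀ τ ∈ Ioo 0 T, graphPoint A γ y τ ∈ Ω := by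
    intro y hy τ hτ
    rw [hchart _ (hDball y hy τ hτ.1.le hτ.2), apply_graphPoint]
    simpa using hτ.1
  have hDfr : ∀ y ∈ D, graphPoint A γ y 0 ∈ frontier Ω := by
    intro y hy
    rw [hΩ.isOpen.frontier_eq]
    constructor
    · refine Metric.mem_closure_iff.2 fun δ hδ => ?_
      have hm : 0 < min δ T := lt_min hδ hT
      refine ⟨graphPoint A γ y (min δ T / 2), hDin y hy _ ⟨by positivity, ?_⟩, ?_⟩
      · linarith [min_le_right δ T]
      · rw [dist_comm, dist_graphPoint, abs_of_pos (by positivity)]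
        linarith [min_le_left δ T]
    · rw [hchart _ (hDball y hy 0 le_rfl hT), apply_graphPoint]
      simp
  have hDU : ∀ y ∈ D, ∀ τ ∈ Ioo 0 T, graphPoint A γ y τ ∈ U := by
    intro y hy τ hτ
    refine ⟨hDin y hy τ hτ, Metric.mem_thickening_iff.2 ⟨_, hDfr y hy, ?_⟩⟩
    rw [dist_graphPoint, abs_of_pos hτ.1]
    exact hτ.2
  have mζ : Measurable fun x => ‖ζ x‖ₑ ^ 2 := (hζ.continuous.measurable.enorm).pow_const 2
  have mg : Measurable fun x => ‖gradient ζ x‖ₑ ^ 2 :=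
    ((continuous_gradient hζ).measurable.enorm).pow_const 2
  rw [← lintegral_indicator hSm,
    lintegral_eq_lintegral_graphPoint (A := A) (γ := γ) (mζ.indicator hSm)]
  -- The bound on the vertical line over y does not depend on s, so integrating it over (0, T)
  -- yields a factor T.
  have hpt : ∀ y, ∫⁻ s, S.indicator (fun x => ‖ζ x‖ₑ ^ 2) (graphPoint A γ y s) ≤
      D.indicator (fun y => ENNReal.ofReal T * (4 * ‖ζ (graphPoint A γ y 0)‖ₑ ^ 2)) y +
      ENNReal.ofReal T * (4 * (ENNReal.ofReal T *
        ∫⁻ τ, U.indicator (fun x => ‖gradient ζ x‖ₑ ^ 2) (graphPoint A γ y τ))) := by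
    intro y
    by_cases hy : y ∈ D
    · rw [indicator_of_mem hy]
      calc ∫⁻ s, S.indicator (fun x => ‖ζ x‖ₑ ^ 2) (graphPoint A γ y s)
          ≤ ∫⁻ s, (Ioo 0 T).indicator (fun _ => 4 * ‖ζ (graphPoint A γ y 0)‖ₑ ^ 2 +
              4 * (ENNReal.ofReal T *
                ∫⁻ τ in Ioo 0 T, ‖gradient ζ (graphPoint A γ y τ)‖ₑ ^ 2)) s := by
            refine lintegral_mono fun s => ?_
            by_cases hs : graphPoint A γ y s ∈ S
            · rw [indicator_of_mem hs, indicator_of_mem (hS1 y s hs).2]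
              exact enorm_sq_graphPoint_le hγ.continuous hζ y (hS1 y s hs).2
            · rw [indicator_of_notMem hs]
              exact zero_le
        _ = ENNReal.ofReal T * (4 * ‖ζ (graphPoint A γ y 0)‖ₑ ^ 2 +
              4 * (ENNReal.ofReal T *
                ∫⁻ τ in Ioo 0 T, ‖gradient ζ (graphPoint A γ y τ)‖ₑ ^ 2)) := by
            rw [lintegral_indicator_const measurableSet_Ioo, Real.volume_Ioo, sub_zero, mul_comm]
        _ ≤ _ := by
            have hle : ∫⁻ τ in Ioo 0 T, ‖gradient ζ (graphPoint A γ y τ)‖ₑ ^ 2 ≤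
                ∫⁻ τ, U.indicator (fun x => ‖gradient ζ x‖ₑ ^ 2) (graphPoint A γ y τ) := by
              rw [← lintegral_indicator measurableSet_Ioo]
              refine lintegral_mono fun τ => ?_
              by_cases hτ : τ ∈ Ioo 0 T
              · rw [indicator_of_mem hτ, indicator_of_mem (hDU y hy τ hτ)]
              · rw [indicator_of_notMem hτ]
                exact zero_le
            rw [mul_add]
            exact add_le_add le_rfl (mul_le_mul_right (mul_le_mul_right
              (mul_le_mul_right hle _) _) _)
    · have : ∀ s, S.indicator (fun x => ‖ζ x‖ₑ ^ 2) (graphPoint A γ y s) = 0 := fun s =>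
        indicator_of_notMem (fun h => hy (hS1 y s h).1) _
      simp [this]
  refine (lintegral_mono hpt).trans ?_
  have mz : Measurable fun y => ‖ζ (graphPoint A γ y 0)‖ₑ ^ 2 := mζ.comp hc0.measurable
  rw [lintegral_add_left (((mz.const_mul 4).const_mul _).indicator hDm), lintegral_indicator hDm,
    lintegral_const_mul _ (mz.const_mul 4), lintegral_const_mul 4 mz]
  have mU : Measurable fun y => ∫⁻ τ, U.indicator (fun x => ‖gradient ζ x‖ₑ ^ 2)
      (graphPoint A γ y τ) :=
    Measurable.lintegral_prod_right
      ((mg.indicator hUm).comp (continuous_graphPoint hγ.continuous).measurable)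
  rw [lintegral_const_mul _ ((mU.const_mul _).const_mul _), lintegral_const_mul _ (mU.const_mul _),
    lintegral_const_mul _ mU,
    ← lintegral_eq_lintegral_graphPoint (A := A) (γ := γ) (mg.indicator hUm),
    lintegral_indicator hUm]
  gcongr
  exact hc D hDm hDfr _ mζ

/-- In a strip of width `t` along the boundary, the `L²` norm is controlled by `√t` times the `L²`
norm on the boundary and by `t` times the `L²` norm of the gradient in a wider strip. -/
lemma exists_strip_estimate (hn : 1 ≤ n) (hΩ : IsBoundedLipschitzDomain Ω) :
    ∃ C : ℝ≥0, ∃ t₀ > 0, ∀ t, 0 < t → t < t₀ → ∀ ζ : E n → ℝ, ContDiff ℝ ∞ ζ →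
      ∫⁻ x in Ω ∩ Metric.thickening t (frontier Ω), ‖ζ x‖ₑ ^ 2 ≤
        C * (ENNReal.ofReal t * ∫⁻ x, ‖ζ x‖ₑ ^ 2 ∂surfaceMeasure Ω + ENNReal.ofReal t ^ 2 *
          ∫⁻ x in Ω ∩ Metric.thickening (C * t) (frontier Ω), ‖gradient ζ x‖ₑ ^ 2) := by
  obtain ⟨c, hc⟩ := exists_lintegral_graph_le hn
  have hK : IsCompact (frontier Ω) :=
    Metric.isCompact_of_isClosed_isBounded isClosed_frontier
      (hΩ.isBounded.closure.subset frontier_subset_closure)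
  -- The estimate near a piece s of the boundary passes to subsets and finite unions, so by
  -- compactness it suffices to prove it near each boundary point.
  let P : Set (E n) → Prop := fun s => ∃ C : ℝ≥0, ∃ t₀ > 0, ∀ t, 0 < t → t < t₀ →
    ∀ ζ : E n → ℝ, ContDiff ℝ ∞ ζ →
      ∫⁻ x in Ω ∩ Metric.thickening t (s ∩ frontier Ω), ‖ζ x‖ₑ ^ 2 ≤
        C * (ENNReal.ofReal t * ∫⁻ x, ‖ζ x‖ₑ ^ 2 ∂surfaceMeasure Ω + ENNReal.ofReal t ^ 2 *
          ∫⁻ x in Ω ∩ Metric.thickening (C * t) (frontier Ω), ‖gradient ζ x‖ₑ ^ 2)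
  suffices h : P (frontier Ω) by simpa only [P, inter_self] using h
  refine hK.induction_on (p := P) ?_ ?_ ?_ ?_
  · exact ⟨0, 1, one_pos, fun t _ _ ζ _ => by simp⟩
  · rintro s s' hs ⟨C, t₀, h0, h⟩
    refine ⟨C, t₀, h0, fun t ht htt ζ hζ => (lintegral_mono_set ?_).trans (h t ht htt ζ hζ)⟩
    exact inter_subset_inter_right _
      (Metric.thickening_subset_of_subset _ (inter_subset_inter_left _ hs))
  · rintro s s' ⟨C, t₀, h0, h⟩ ⟨C', t₀', h0', h'⟩
    refine ⟨C + C', min t₀ t₀', lt_min h0 h0', fun t ht htt ζ hζ => ?_⟩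
    have e : Ω ∩ Metric.thickening t ((s ∪ s') ∩ frontier Ω) =
        (Ω ∩ Metric.thickening t (s ∩ frontier Ω)) ∪
          (Ω ∩ Metric.thickening t (s' ∩ frontier Ω)) := by
      rw [union_inter_distrib_right, Metric.thickening_union, inter_union_distrib_left]
    rw [e]
    refine (lintegral_union_le _ _ _).trans ((add_le_add
      (h t ht (htt.trans_le (min_le_left _ _)) ζ hζ)
      (h' t ht (htt.trans_le (min_le_right _ _)) ζ hζ)).trans ?_)
    rw [NNReal.coe_add, ENNReal.coe_add, add_mul]
    have m1 : Metric.thickening (C * t) (frontier Ω) ⊆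
        Metric.thickening ((C + C' : ℝ) * t) (frontier Ω) :=
      Metric.thickening_mono (mul_le_mul_of_nonneg_right (by simp) ht.le) _
    have m2 : Metric.thickening (C' * t) (frontier Ω) ⊆
        Metric.thickening ((C + C' : ℝ) * t) (frontier Ω) :=
      Metric.thickening_mono (mul_le_mul_of_nonneg_right (by simp) ht.le) _
    gcongr
  · intro x₀ hx₀
    obtain ⟨A, γ, L, r, hγ, hr, hchart⟩ := hΩ.lipschitz_boundary x₀ hx₀
    -- The threshold gives t + (1 + L)t < r/4, and the constant dominates 4(1 + L)c, 4(1 + L)² and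
    -- the strip-widening factor 1 + L.
    refine ⟨Metric.ball x₀ (r / 2),
      mem_nhdsWithin_of_mem_nhds (Metric.ball_mem_nhds x₀ (by positivity)),
      4 * (1 + L) ^ 2 * (1 + c), r / 4 / (2 + L), by positivity, fun t ht htt ζ hζ => ?_⟩
    have htr : t + (1 + L) * t < r / 4 := by
      rw [lt_div_iff₀ (by positivity)] at htt
      linarith
    refine (lintegral_strip_chart_le hΩ hγ hchart (hc Ω A γ hγ.continuous) rfl ht htr hζ).trans ?_
    have hT : ENNReal.ofReal ((1 + L) * t) = (1 + L) * ENNReal.ofReal t := by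
      rw [ENNReal.ofReal_mul (by positivity), ENNReal.ofReal_add (by positivity) (by positivity)]
      simp
    have hL : (1 : ℝ≥0∞) + L ≤ (1 + L) ^ 2 := by
      rw [sq]; exact le_mul_of_one_le_left zero_le le_self_add
    have m1 : Metric.thickening ((1 + L) * t) (frontier Ω) ⊆
        Metric.thickening (((4 * (1 + L) ^ 2 * (1 + c) : ℝ≥0) : ℝ) * t) (frontier Ω) := by
      refine Metric.thickening_mono (mul_le_mul_of_nonneg_right ?_ ht.le) _
      push_cast
      nlinarith [L.2, c.2, mul_nonneg L.2 c.2, mul_nonneg (mul_nonneg L.2 L.2) c.2,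
        mul_nonneg L.2 L.2]
    rw [hT]
    generalize hI : ∫⁻ x, ‖ζ x‖ₑ ^ 2 ∂surfaceMeasure Ω = I
    have hJ := lintegral_mono_set (μ := volume) (f := fun x => ‖gradient ζ x‖ₑ ^ 2)
      (inter_subset_inter_right Ω m1)
    revert hJ
    generalize ∫⁻ x in Ω ∩ Metric.thickening ((1 + L) * t) (frontier Ω), ‖gradient ζ x‖ₑ ^ 2 = J
    intro hJ
    push_cast at hJ ⊢
    refine le_trans (b := 4 * (1 + (L : ℝ≥0∞)) ^ 2 * (1 + c) *
      (ENNReal.ofReal t * I + ENNReal.ofReal t ^ 2 * J)) ?_ (by gcongr)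
    calc (1 + (L : ℝ≥0∞)) * ENNReal.ofReal t * (4 * (c * I)) +
          (1 + L) * ENNReal.ofReal t * (4 * ((1 + L) * ENNReal.ofReal t * J))
        = 4 * (1 + L) * c * (ENNReal.ofReal t * I) +
            4 * (1 + L) ^ 2 * 1 * (ENNReal.ofReal t ^ 2 * J) := by ring
      _ ≤ 4 * (1 + L) ^ 2 * (1 + c) * (ENNReal.ofReal t * I) +
            4 * (1 + L) ^ 2 * (1 + c) * (ENNReal.ofReal t ^ 2 * J) := by
          gcongr
          · exact le_add_self
          · exact le_self_add
      _ = _ := by rw [← mul_add]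

end Chart

/-! ### Zero trace implies membership in H₀¹. -/

section ZeroTrace

variable {n : ℕ} {Ω : Set (E n)}

lemma le_infDist_compl_of_notMem_thickening (hne : Ω ≠ univ) {t : ℝ} {x : E n} (hx : x ∈ Ω)
    (hxt : x ∉ Metric.thickening t (frontier Ω)) : t ≤ Metric.infDist x Ωᶜ := by
  obtain ⟨p, hp, hd⟩ := exists_mem_frontier_infDist_compl_eq_dist hx hne
  by_contra h
  exact hxt (Metric.mem_thickening_iff.2 ⟨p, hp, by rw [← hd]; exact not_le.1 h⟩)

lemma gradient_eq_zero_of_eq_one {χ : E n → ℝ} (h1 : ∀ x, χ x ≤ 1) {x : E n} (hx : χ x = 1) :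
    gradient χ x = 0 := by
  have : IsLocalMax χ x := Eventually.of_forall fun y => by rw [hx]; exact h1 y
  simp [gradient, this.fderiv_eq_zero]

/-- Absolute continuity of the integral. The frontier is disjoint from the open set Ω, so the
measure of its thickenings inside Ω tends to 0; the frontier need not be a Lebesgue null set for
this. -/
lemma exists_eLpNorm_thickening_le {F : Type*} [NormedAddCommGroup F]
    (hΩo : IsOpen Ω) (hΩ : Bornology.IsBounded Ω)
    {f : E n → F} (hf : MemLp f 2 (volume.restrict Ω)) {δ : ℝ} (hδ : 0 < δ) :
    ∃ τ > 0, ∀ t ≤ τ,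
      eLpNorm ((Metric.thickening t (frontier Ω)).indicator f) 2 (volume.restrict Ω) ≤
        ENNReal.ofReal δ := by
  obtain ⟨η, hη, h⟩ := hf.eLpNorm_indicator_le (by norm_num) (by norm_num) hδ
  have : IsFiniteMeasure (volume.restrict Ω) := ⟨by simpa using hΩ.measure_lt_top⟩
  have ht := tendsto_measure_thickening_of_isClosed (μ := volume.restrict Ω) (s := frontier Ω)
    ⟨1, one_pos, measure_ne_top _ _⟩ isClosed_frontier
  have h0 : (volume.restrict Ω) (frontier Ω) = 0 := by
    rw [Measure.restrict_apply isClosed_frontier.measurableSet, hΩo.frontier_eq]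
    simp
  rw [h0] at ht
  have hev := (ht.eventually_le_const (ENNReal.ofReal_pos.2 hη)).and self_mem_nhdsWithin
  obtain ⟨τ, hτ, hτ0⟩ := hev.exists
  refine ⟨τ, hτ0, fun t htτ => h _ Metric.isOpen_thickening.measurableSet ?_⟩
  exact (measure_mono (Metric.thickening_mono htτ _)).trans hτ

/-- An `H¹` limit of smooth functions whose boundary values tend to zero can be approximated by
test functions. -/
lemma exists_testFunction_near (hn : 1 ≤ n) (hΩ : IsBoundedLipschitzDomain Ω) {ζ : ℕ → E n → ℝ}
    {u : L2 Ω} {g : L2Vec Ω} (hζ : ∀ k, ContDiff ℝ ∞ (ζ k)) (hlim : TendstoH1 Ω ζ u g)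
    (htrace : Tendsto (fun k => eLpNorm (ζ k) 2 (surfaceMeasure Ω)) atTop (𝓝 0)) :
    ∃ K : ℝ≥0, ∀ δ : ℝ, 0 < δ → ∃ ψ : E n → ℝ, IsTestFunction Ω ψ ∧
      eLpNorm (fun x => ψ x - u x) 2 (volume.restrict Ω) ≤ K * ENNReal.ofReal δ ∧
      eLpNorm (fun x => gradient ψ x - g x) 2 (volume.restrict Ω) ≤ K * ENNReal.ofReal δ := by
  obtain ⟨C, t₀, ht₀, hstrip⟩ := exists_strip_estimate hn hΩ
  have hne : Ω ≠ univ := by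
    rintro rfl
    have : Nontrivial (E n) := by
      have : Nonempty (Fin n) := ⟨⟨0, hn⟩⟩
      infer_instance
    exact NormedSpace.unbounded_univ ℝ (E n) hΩ.isBounded
  -- The gradient estimate costs δ + δ + 10(1 + C)δ; the function itself only costs 2δ.
  refine ⟨12 + 10 * C, fun δ hδ => ?_⟩
  obtain ⟨τ₁, hτ₁, hu⟩ := exists_eLpNorm_thickening_le hΩ.isOpen hΩ.isBounded (Lp.memLp u) hδ
  obtain ⟨τ₂, hτ₂, hg⟩ := exists_eLpNorm_thickening_le hΩ.isOpen hΩ.isBounded (Lp.memLp g) hδ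
  obtain ⟨t, ht, htt₀, htτ₁, htτ₂, hCt⟩ : ∃ t, 0 < t ∧ t < t₀ ∧ t ≤ τ₁ ∧ t ≤ τ₂ ∧ C * t ≤ τ₂ := by
    refine ⟨min (t₀ / 2) (min τ₁ (τ₂ / (C + 1))), by positivity, ?_, ?_, ?_, ?_⟩
    · exact (min_le_left _ _).trans_lt (by linarith)
    · exact (min_le_right _ _).trans (min_le_left _ _)
    · refine ((min_le_right _ _).trans (min_le_right _ _)).trans (div_le_self hτ₂.le ?_)
      simp
    · have h := (min_le_right (t₀ / 2) (min τ₁ (τ₂ / (C + 1)))).trans (min_le_right _ _)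
      rw [le_div_iff₀ (by positivity)] at h
      have h0 : 0 < min (t₀ / 2) (min τ₁ (τ₂ / (C + 1))) := by positivity
      linarith
  set δ' := ENNReal.ofReal δ with hδ'
  have hδ0 : 0 < δ' := ENNReal.ofReal_pos.2 hδ
  set t' := ENNReal.ofReal t with ht'
  have ht0 : t' ≠ 0 := (ENNReal.ofReal_pos.2 ht).ne'
  have hb : Tendsto (fun k => eLpNorm (ζ k) 2 (surfaceMeasure Ω) ^ 2) atTop (𝓝 0) := by
    simpa [Function.comp_def] using ((ENNReal.continuous_pow 2).tendsto 0).comp htrace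
  -- The strip width t is fixed before k: the squared boundary norm of ζ k must be at most tδ² to
  -- match the t² scaling of the gradient term.
  obtain ⟨k, hk1, hk2, hk3⟩ := ((hlim.1.eventually_le_const hδ0).and
    ((hlim.2.eventually_le_const hδ0).and
      (hb.eventually_le_const (show 0 < t' * δ' ^ 2 from
        pos_iff_ne_zero.2 (mul_ne_zero ht0 (pow_ne_zero 2 hδ0.ne')))))).exists
  obtain ⟨χ, hχ, hχ0, hχ1, hχg, hχone⟩ := exists_smooth_cutoff hΩ.isBounded ht
  set N := Metric.thickening t (frontier Ω) with hN
  set N' := Metric.thickening (C * t) (frontier Ω) with hN'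
  set μ := volume.restrict Ω with hμ
  have hNm : MeasurableSet N := Metric.isOpen_thickening.measurableSet
  have hNm' : MeasurableSet N' := Metric.isOpen_thickening.measurableSet
  have hone : ∀ x ∈ Ω, x ∉ N → χ x = 1 := fun x hx hxN =>
    hχone x (le_infDist_compl_of_notMem_thickening hne hx hxN)
  have hχabs : ∀ x, ‖χ x‖ ≤ 1 := fun x => by
    rw [Real.norm_eq_abs, abs_of_nonneg (hχ0 x)]; exact hχ1 x
  have hχabs' : ∀ x, ‖χ x - 1‖ ≤ 1 := fun x => by
    rw [Real.norm_eq_abs, abs_le]; constructor <;> linarith [hχ0 x, hχ1 x]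
  have cχ := hχ.contDiff.continuous
  have cζ := (hζ k).continuous
  have cgζ := continuous_gradient (hζ k)
  have cgχ := continuous_gradient hχ.contDiff
  have mem_Ω : ∀ᵐ x ∂μ, x ∈ Ω := ae_restrict_mem hΩ.isOpen.measurableSet
  have hgN' : eLpNorm (N'.indicator (gradient (ζ k))) 2 μ ≤ 2 * δ' := by
    have e : N'.indicator (gradient (ζ k)) =
        N'.indicator (fun x => gradient (ζ k) x - g x) + N'.indicator g := by
      rw [← indicator_add']; congr 1; ext1 x; simp
    rw [e, two_mul]
    refine (eLpNorm_add_le ((cgζ.aestronglyMeasurable.sub (Lp.aestronglyMeasurable g)).indicator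
      hNm') ((Lp.aestronglyMeasurable g).indicator hNm') (by norm_num)).trans (add_le_add ?_ ?_)
    · exact (eLpNorm_indicator_le _).trans hk2
    · exact hg _ hCt
  have hζN : eLpNorm (N.indicator (ζ k)) 2 μ ^ 2 ≤ t' ^ 2 * (C * (5 * δ' ^ 2)) := by
    have hs := hstrip t ht htt₀ (ζ k) (hζ k)
    rw [inter_comm Ω, inter_comm Ω, ← Measure.restrict_restrict hNm,
      ← Measure.restrict_restrict hNm', ← eLpNorm_two_sq, ← eLpNorm_two_sq, ← eLpNorm_two_sq,
      ← eLpNorm_indicator_eq_eLpNorm_restrict hNm, ← eLpNorm_indicator_eq_eLpNorm_restrict hNm']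
      at hs
    refine hs.trans ?_
    calc C * (t' * eLpNorm (ζ k) 2 (surfaceMeasure Ω) ^ 2 +
          t' ^ 2 * eLpNorm (N'.indicator (gradient (ζ k))) 2 μ ^ 2)
        ≤ C * (t' * (t' * δ' ^ 2) + t' ^ 2 * (2 * δ') ^ 2) := by gcongr
      _ = t' ^ 2 * (C * (5 * δ' ^ 2)) := by ring
  -- The critical term of the product rule: |∇χ| ≤ 4/t cancels the factor t in the strip bound,
  -- leaving 16 · 5C δ² = 80C δ² ≤ (10(1 + C)δ)².
  have hX : eLpNorm (N.indicator fun x => ζ k x • gradient χ x) 2 μ ≤ (10 * (1 + C)) * δ' := by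
    have h1 : eLpNorm (N.indicator fun x => ζ k x • gradient χ x) 2 μ ≤
        ENNReal.ofReal (4 / t) * eLpNorm (N.indicator (ζ k)) 2 μ := by
      refine eLpNorm_le_mul_eLpNorm_of_ae_le_mul (Eventually.of_forall fun x => ?_) 2
      by_cases hx : x ∈ N
      · rw [indicator_of_mem hx, indicator_of_mem hx, norm_smul, mul_comm]
        exact mul_le_mul_of_nonneg_right (hχg x) (norm_nonneg _)
      · rw [indicator_of_notMem hx, indicator_of_notMem hx]
        simp
    refine (ENNReal.pow_le_pow_left_iff two_ne_zero).1 ?_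
    calc eLpNorm (N.indicator fun x => ζ k x • gradient χ x) 2 μ ^ 2
        ≤ (ENNReal.ofReal (4 / t) * eLpNorm (N.indicator (ζ k)) 2 μ) ^ 2 := by gcongr
      _ = ENNReal.ofReal (4 / t) ^ 2 * eLpNorm (N.indicator (ζ k)) 2 μ ^ 2 := by rw [mul_pow]
      _ ≤ ENNReal.ofReal (4 / t) ^ 2 * (t' ^ 2 * (C * (5 * δ' ^ 2))) := by gcongr
      _ = (ENNReal.ofReal (4 / t) * t') ^ 2 * (C * (5 * δ' ^ 2)) := by ring
      _ = 4 ^ 2 * (C * (5 * δ' ^ 2)) := by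
          rw [ht', ← ENNReal.ofReal_mul (by positivity), div_mul_cancel₀ _ ht.ne']
          norm_num
      _ = 80 * C * δ' ^ 2 := by ring
      _ ≤ (100 + 200 * C + 100 * C ^ 2) * δ' ^ 2 := by
          gcongr
          calc (80 : ℝ≥0∞) * C ≤ 200 * C := by gcongr; norm_num
            _ ≤ 100 + 200 * C := le_add_self
            _ ≤ _ := le_self_add
      _ = ((10 * (1 + C)) * δ') ^ 2 := by ring
  refine ⟨fun x => χ x * ζ k x, ⟨hχ.contDiff.mul (hζ k), hχ.hasCompactSupport.mul_right,
    tsupport_mul_subset_left.trans hχ.tsupport_subset⟩, ?_, ?_⟩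
  · have e : (fun x => χ x * ζ k x - u x) =
        (fun x => χ x * (ζ k x - u x)) + fun x => (χ x - 1) * u x := by
      ext x; simp only [Pi.add_apply]; ring
    rw [e]
    have m1 : AEStronglyMeasurable (fun x => χ x * (ζ k x - u x)) μ :=
      cχ.aestronglyMeasurable.mul (cζ.aestronglyMeasurable.sub (Lp.aestronglyMeasurable u))
    have m2 : AEStronglyMeasurable (fun x => (χ x - 1) * u x) μ :=
      (cχ.sub continuous_const).aestronglyMeasurable.mul (Lp.aestronglyMeasurable u)
    refine (eLpNorm_add_le m1 m2 (by norm_num)).trans ?_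
    calc _ ≤ δ' + δ' := by
          refine add_le_add ((eLpNorm_mono fun x => ?_).trans hk1)
            ((eLpNorm_mono_ae ?_).trans (hu t htτ₁))
          · rw [norm_mul]; exact mul_le_of_le_one_left (norm_nonneg _) (hχabs x)
          · filter_upwards [mem_Ω] with x hx
            by_cases hxN : x ∈ N
            · rw [indicator_of_mem hxN, norm_mul]
              exact mul_le_of_le_one_left (norm_nonneg _) (hχabs' x)
            · rw [hone x hx hxN]; simp
      _ = 2 * δ' := (two_mul _).symm
      _ ≤ _ := by
          gcongr
          push_cast
          exact le_trans (by norm_num) le_self_add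
  · have e : (fun x => gradient (fun y => χ y * ζ k y) x - g x) =
        ((fun x => χ x • (gradient (ζ k) x - g x)) + fun x => (χ x - 1) • g x) +
          fun x => ζ k x • gradient χ x := by
      ext1 x
      rw [gradient_mul (hχ.contDiff.differentiable (by simp) x)
        ((hζ k).differentiable (by simp) x)]
      simp only [Pi.add_apply, smul_sub, sub_smul, one_smul]
      abel
    rw [e]
    have m2 : AEStronglyMeasurable (fun x => χ x • (gradient (ζ k) x - g x)) μ :=
      cχ.aestronglyMeasurable.smul (cgζ.aestronglyMeasurable.sub (Lp.aestronglyMeasurable g))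
    have m3 : AEStronglyMeasurable (fun x => (χ x - 1) • g x) μ :=
      (cχ.sub continuous_const).aestronglyMeasurable.smul (Lp.aestronglyMeasurable g)
    have m4 : AEStronglyMeasurable (fun x => ζ k x • gradient χ x) μ :=
      (cζ.smul cgχ).aestronglyMeasurable
    refine (eLpNorm_add_le (m2.add m3) m4 (by norm_num)).trans ?_
    calc _ ≤ (δ' + δ') + (10 * (1 + C)) * δ' := by
          refine add_le_add ((eLpNorm_add_le m2 m3 (by norm_num)).trans (add_le_add
            ((eLpNorm_mono fun x => ?_).trans hk2)
            ((eLpNorm_mono_ae ?_).trans (hg t htτ₂)))) ((eLpNorm_mono_ae ?_).trans hX)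
          · rw [norm_smul]; exact mul_le_of_le_one_left (norm_nonneg _) (hχabs x)
          · filter_upwards [mem_Ω] with x hx
            by_cases hxN : x ∈ N
            · rw [indicator_of_mem hxN, norm_smul]
              exact mul_le_of_le_one_left (norm_nonneg _) (hχabs' x)
            · rw [hone x hx hxN]; simp
          · filter_upwards [mem_Ω] with x hx
            by_cases hxN : x ∈ N
            · rw [indicator_of_mem hxN]
            · rw [gradient_eq_zero_of_eq_one hχ1 (hone x hx hxN)]; simp
      _ = _ := by push_cast; ring

/-- Functions with zero trace belong to `H₀¹`. -/
lemma memH10_of_tendsto_zero (hn : 1 ≤ n) (hΩ : IsBoundedLipschitzDomain Ω) {ζ : ℕ → E n → ℝ}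
    {u : L2 Ω} {g : L2Vec Ω} (hζ : ∀ k, ContDiff ℝ ∞ (ζ k)) (hlim : TendstoH1 Ω ζ u g)
    (htrace : Tendsto (fun k => eLpNorm (ζ k) 2 (surfaceMeasure Ω)) atTop (𝓝 0)) :
    MemH10 Ω u g := by
  refine ⟨hlim.hasWeakGradient hΩ.isBounded hζ, ?_⟩
  obtain ⟨K, hK⟩ := exists_testFunction_near hn hΩ hζ hlim htrace
  choose ψ hψ h1 h2 using fun k : ℕ => hK (1 / ((k : ℝ) + 1)) (by positivity)
  have t0 : Tendsto (fun k : ℕ => K * ENNReal.ofReal (1 / ((k : ℝ) + 1))) atTop (𝓝 0) := by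
    have := ENNReal.Tendsto.const_mul (a := K)
      (ENNReal.tendsto_ofReal (tendsto_one_div_add_atTop_nhds_zero_nat (𝕜 := ℝ)))
      (Or.inr ENNReal.coe_ne_top)
    simpa using this
  exact ⟨ψ, hψ, tendsto_of_tendsto_of_tendsto_of_le_of_le tendsto_const_nhds t0
    (fun _ => zero_le) h1, tendsto_of_tendsto_of_tendsto_of_le_of_le tendsto_const_nhds t0
    (fun _ => zero_le) h2⟩

end ZeroTrace

/-! ### Smooth truncation in H¹. -/

section Truncation

/-- A smooth substitute for (s - m)⁺, the primitive of a smooth step. Smoothness keeps F ∘ ζ smooth,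
and strict positivity beyond m lets F(z) = 0 be read as z ≤ m. -/
lemma exists_smooth_ramp (m : ℝ) : ∃ F : ℝ → ℝ, ContDiff ℝ ∞ F ∧ (∀ s ≤ m, F s = 0) ∧
    (∀ s, m < s → 0 < F s) ∧ (∀ s, 0 ≤ deriv F s) ∧ ∀ s, deriv F s ≤ 1 := by
  have hc : Continuous Real.smoothTransition := Real.smoothTransition.continuous
  let F : ℝ → ℝ := fun s => ∫ x in (0 : ℝ)..(s - m), Real.smoothTransition x
  have hF : ∀ s, HasDerivAt F (Real.smoothTransition (s - m)) s := fun s => by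
    have h := intervalIntegral.integral_hasDerivAt_right (hc.intervalIntegrable 0 (s - m))
      (hc.stronglyMeasurableAtFilter _ _) hc.continuousAt
    have h' := h.comp s ((hasDerivAt_id s).sub_const m)
    rw [mul_one] at h'
    exact h'
  have hd : deriv F = fun s => Real.smoothTransition (s - m) := funext fun s => (hF s).deriv
  refine ⟨F, ?_, fun s hs => ?_, fun s hs => ?_, fun s => ?_, fun s => ?_⟩
  · rw [contDiff_infty_iff_deriv, hd]
    exact ⟨fun s => (hF s).differentiableAt,
      Real.smoothTransition.contDiff.comp (contDiff_id.sub contDiff_const)⟩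
  · have : ∀ x ∈ uIcc 0 (s - m), Real.smoothTransition x = 0 := fun x hx => by
      rw [uIcc_of_ge (by linarith)] at hx
      exact Real.smoothTransition.zero_of_nonpos hx.2
    exact (intervalIntegral.integral_congr this).trans (by simp)
  · exact intervalIntegral.intervalIntegral_pos_of_pos_on (hc.intervalIntegrable _ _)
      (fun x hx => Real.smoothTransition.pos_of_pos hx.1) (by linarith)
  · rw [hd]; exact Real.smoothTransition.nonneg _
  · rw [hd]; exact Real.smoothTransition.le_one _

lemma abs_sub_le_of_deriv_le_one {F : ℝ → ℝ} (hF : Differentiable ℝ F) (h0 : ∀ s, 0 ≤ deriv F s)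
    (h1 : ∀ s, deriv F s ≤ 1) (a b : ℝ) : |F a - F b| ≤ |a - b| := by
  have h : LipschitzWith 1 F := lipschitzWith_of_nnnorm_deriv_le hF fun s => by
    rw [← NNReal.coe_le_coe, coe_nnnorm, Real.norm_eq_abs, abs_of_nonneg (h0 s)]
    exact h1 s
  simpa [Real.dist_eq] using h.dist_le_mul a b

variable {n : ℕ} {Ω : Set (E n)}

lemma tendsto_eLpNorm_two_of_lintegral_sq {α F : Type*} [MeasurableSpace α] [NormedAddCommGroup F]
    {μ : Measure α} {f : ℕ → α → F} (h : Tendsto (fun k => ∫⁻ x, ‖f k x‖ₑ ^ 2 ∂μ) atTop (𝓝 0)) :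
    Tendsto (fun k => eLpNorm (f k) 2 μ) atTop (𝓝 0) := by
  simp only [← eLpNorm_two_sq] at h
  have h2 := ((ENNReal.continuous_rpow_const (y := 1 / 2)).tendsto 0).comp h
  have e : ∀ k, (eLpNorm (f k) 2 μ ^ 2) ^ (1 / 2 : ℝ) = eLpNorm (f k) 2 μ := fun k => by
    rw [← ENNReal.rpow_natCast, ← ENNReal.rpow_mul]; norm_num
  rw [ENNReal.zero_rpow_of_pos (by norm_num)] at h2
  exact h2.congr e

/-- Composition with a smooth function of bounded derivative acts on `H¹`, with the chain rule. -/
lemma TendstoH1.comp {ζ : ℕ → E n → ℝ} {z : L2 Ω} {g : L2Vec Ω} (hζ : ∀ k, ContDiff ℝ ∞ (ζ k))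
    (h : TendstoH1 Ω ζ z g) {F : ℝ → ℝ} (hF : ContDiff ℝ ∞ F) (hF0 : F 0 = 0)
    (hd0 : ∀ s, 0 ≤ deriv F s) (hd1 : ∀ s, deriv F s ≤ 1) :
    ∃ (w : L2 Ω) (k : L2Vec Ω) (ns : ℕ → ℕ), StrictMono ns ∧
      w =ᵐ[volume.restrict Ω] (fun x => F (z x)) ∧
      k =ᵐ[volume.restrict Ω] (fun x => deriv F (z x) • g x) ∧
      TendstoH1 Ω (fun j x => F (ζ (ns j) x)) w k := by
  set μ := volume.restrict Ω with hμ
  have dF : Differentiable ℝ F := hF.differentiable (by simp)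
  have cF' : Continuous (deriv F) := hF.continuous_deriv (by simp)
  have hlip := abs_sub_le_of_deriv_le_one dF hd0 hd1
  have hdn : ∀ s, ‖deriv F s‖ ≤ 1 := fun s => by
    rw [Real.norm_eq_abs, abs_of_nonneg (hd0 s)]; exact hd1 s
  have hdn2 : ∀ s s', ‖deriv F s - deriv F s'‖ ≤ 1 := fun s s' => by
    rw [Real.norm_eq_abs, abs_le]
    constructor <;> linarith [hd0 s, hd1 s, hd0 s', hd1 s']
  have mz := Lp.aestronglyMeasurable z
  have mg := Lp.aestronglyMeasurable g
  have mw : MemLp (fun x => F (z x)) 2 μ := by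
    refine MemLp.of_le (Lp.memLp z) (hF.continuous.comp_aestronglyMeasurable mz)
      (Eventually.of_forall fun x => ?_)
    simpa [hF0] using hlip (z x) 0
  have mF'z := cF'.comp_aestronglyMeasurable mz
  have mk : MemLp (fun x => deriv F (z x) • g x) 2 μ := by
    refine MemLp.of_le (Lp.memLp g) (mF'z.smul mg) (Eventually.of_forall fun x => ?_)
    rw [norm_smul]
    exact mul_le_of_le_one_left (norm_nonneg _) (hdn _)
  -- A subsequence converging almost everywhere is needed for F'(ζ) → F'(z). Then (F'(ζ) - F'(z))g
  -- tends to 0 in L² by dominated convergence, while F'(ζ)(∇ζ - g) is controlled by F' ≤ 1.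
  have hmeas : TendstoInMeasure μ ζ atTop z :=
    tendstoInMeasure_of_tendsto_eLpNorm (p := 2) (by norm_num)
      (fun k => (hζ k).continuous.aestronglyMeasurable) mz h.1
  obtain ⟨ns, hns, hae⟩ := hmeas.exists_seq_tendsto_ae
  refine ⟨mw.toLp _, mk.toLp _, ns, hns, mw.coeFn_toLp, mk.coeFn_toLp, ?_, ?_⟩
  · refine tendsto_of_tendsto_of_tendsto_of_le_of_le tendsto_const_nhds
      (h.1.comp hns.tendsto_atTop) (fun _ => zero_le) fun j => ?_
    refine eLpNorm_mono_ae ?_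
    filter_upwards [mw.coeFn_toLp] with x hx
    rw [hx]
    exact hlip _ _
  · have t2 : Tendsto (fun j => eLpNorm
        (fun x => (deriv F (ζ (ns j) x) - deriv F (z x)) • g x) 2 μ) atTop (𝓝 0) := by
      refine tendsto_eLpNorm_two_of_lintegral_sq ?_
      have hb : ∫⁻ x, ‖g x‖ₑ ^ 2 ∂μ ≠ ⊤ := by
        rw [← eLpNorm_two_sq]
        exact ENNReal.pow_ne_top (Lp.memLp g).2.ne
      have := tendsto_lintegral_of_dominated_convergence' (μ := μ) (f := fun _ => 0)
        (F := fun j x => ‖(deriv F (ζ (ns j) x) - deriv F (z x)) • g x‖ₑ ^ 2)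
        (fun x => ‖g x‖ₑ ^ 2) (fun j => ?_) (fun j => ?_) hb ?_
      · simpa using this
      · exact ((((cF'.comp (hζ (ns j)).continuous).aestronglyMeasurable.sub mF'z).smul
          mg).enorm).pow_const 2
      · refine Eventually.of_forall fun x => pow_le_pow_left' ?_ 2
        rw [enorm_le_iff_norm_le, norm_smul]
        exact mul_le_of_le_one_left (norm_nonneg _) (hdn2 _ _)
      · filter_upwards [hae] with x hx
        have hx' : Tendsto (fun j => (deriv F (ζ (ns j) x) - deriv F (z x)) • g x) atTop
            (𝓝 0) := by
          have := (((cF'.tendsto (z x)).comp hx).sub_const (deriv F (z x))).smul_const (g x)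
          simpa using this
        have := (ENNReal.continuous_pow 2).tendsto 0 |>.comp (by simpa using hx'.enorm)
        simpa [Function.comp_def] using this
    refine tendsto_of_tendsto_of_tendsto_of_le_of_le tendsto_const_nhds
      (by simpa using (h.2.comp hns.tendsto_atTop).add t2) (fun _ => zero_le) fun j => ?_
    have cF := (cF'.comp (hζ (ns j)).continuous).aestronglyMeasurable (μ := μ)
    have m2 : AEStronglyMeasurable (fun x => (deriv F (ζ (ns j) x) - deriv F (z x)) • g x) μ :=
      (cF.sub mF'z).smul mg
    have m3 : AEStronglyMeasurable
        (fun x => deriv F (ζ (ns j) x) • (gradient (ζ (ns j)) x - g x)) μ :=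
      cF.smul ((continuous_gradient (hζ (ns j))).aestronglyMeasurable.sub mg)
    calc eLpNorm (fun x => gradient (fun y => F (ζ (ns j) y)) x - mk.toLp _ x) 2 μ
        = eLpNorm ((fun x => deriv F (ζ (ns j) x) • (gradient (ζ (ns j)) x - g x)) +
            fun x => (deriv F (ζ (ns j) x) - deriv F (z x)) • g x) 2 μ := by
          refine eLpNorm_congr_ae ?_
          filter_upwards [mk.coeFn_toLp] with x hx
          rw [hx, gradient_comp (dF _) ((hζ (ns j)).differentiable (by simp) x)]
          simp only [Pi.add_apply, smul_sub, sub_smul]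
          abel
      _ ≤ _ := (eLpNorm_add_le m3 m2 (by norm_num)).trans (add_le_add_left
          (eLpNorm_mono fun x => ?_) _)
    rw [norm_smul]
    exact mul_le_of_le_one_left (norm_nonneg _) (hdn _)

end Truncation

/-! ### The scalar Dirichlet problem: maximum principle, existence, uniqueness. -/

section Dirichlet

variable {n : ℕ} {Ω : Set (E n)}

/-- The weak maximum principle. -/
lemma SolvesDirichlet.ae_le (hn : 1 ≤ n) (hΩ : IsBoundedLipschitzDomain Ω) {ε : ℝ} (hε : 0 < ε)
    {q φ : E n → ℝ} (hq0 : ∀ x, 0 ≤ q x) {z : L2 Ω} (hz : SolvesDirichlet Ω ε q φ z) {m : ℝ}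
    (hm : 0 ≤ m) (hφ : ∀ᵐ x ∂surfaceMeasure Ω, φ x ≤ m) :
    ∀ᵐ x ∂volume.restrict Ω, z x ≤ m := by
  obtain ⟨⟨g, hg, hweak⟩, hφ2, g', hg', ζ, hζ, hlim, htr⟩ := hz
  obtain rfl := hg.unique hΩ.isOpen hg'
  obtain ⟨F, hF, hFz, hFpos, hd0, hd1⟩ := exists_smooth_ramp m
  obtain ⟨w, k, ns, hns, hw, hk, hlim'⟩ := hlim.comp hζ hF (hFz 0 hm) hd0 hd1
  -- On the boundary F(φ) = 0 because φ ≤ m, and F is 1-Lipschitz, so |F(ζ)| ≤ |ζ - φ|.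
  have htr' : Tendsto (fun j => eLpNorm (fun x => F (ζ (ns j) x)) 2 (surfaceMeasure Ω)) atTop
      (𝓝 0) := by
    refine tendsto_of_tendsto_of_tendsto_of_le_of_le tendsto_const_nhds
      (htr.comp hns.tendsto_atTop) (fun _ => zero_le) fun j => eLpNorm_mono_ae ?_
    filter_upwards [hφ] with x hx
    have := abs_sub_le_of_deriv_le_one (hF.differentiable (by simp)) hd0 hd1 (ζ (ns j) x) (φ x)
    rwa [hFz _ hx, sub_zero] at this
  have hmem : MemH10 Ω w k :=
    memH10_of_tendsto_zero hn hΩ (fun j => hF.comp (hζ (ns j))) hlim' htr'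
  have heq := hweak w k hmem
  -- Here k = F'(z)g, and (F')² ≤ F' since 0 ≤ F' ≤ 1.
  have h1 : ‖k‖ ^ 2 ≤ ∫ x in Ω, inner ℝ (g x) (k x) := by
    rw [← real_inner_self_eq_norm_sq, L2.inner_def]
    refine integral_mono_ae (L2.integrable_inner k k) (L2.integrable_inner g k) ?_
    filter_upwards [hk] with x hx
    rw [hx, inner_smul_left, inner_smul_right]
    simp only [conj_trivial]
    exact mul_le_of_le_one_left (mul_nonneg (hd0 _) real_inner_self_nonneg) (hd1 _)
  -- Where F(z) does not vanish, z > m ≥ 0; this is the use of m ≥ 0 for the zeroth-order term.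
  have h2 : 0 ≤ ∫ x in Ω, q x / ε * z x * w x := by
    refine integral_nonneg_of_ae ?_
    filter_upwards [hw] with x hx
    rw [hx, Pi.zero_apply, mul_assoc]
    refine mul_nonneg (div_nonneg (hq0 x) hε.le) ?_
    rcases le_or_gt (z x) m with h | h
    · rw [hFz _ h, mul_zero]
    · exact mul_nonneg (hm.trans h.le) (hFpos _ h).le
  have hk0 : ‖k‖ = 0 := by
    have : ‖k‖ ^ 2 ≤ 0 := by linarith
    exact pow_eq_zero_iff two_ne_zero |>.1 (le_antisymm this (by positivity))
  obtain ⟨C, hC⟩ := exists_poincare hn hΩ.isBounded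
  have hw0 : w = 0 := by
    have := hmem.norm_le hC
    rw [hk0, mul_zero] at this
    exact norm_le_zero_iff.1 this
  rw [hw0] at hw
  filter_upwards [hw, Lp.coeFn_zero ℝ 2 (volume.restrict Ω)] with x hx h0
  rw [h0] at hx
  by_contra h
  exact (hFpos _ (not_le.1 h)).ne hx

lemma HasWeakGradient.lincomb {z₁ z₂ : L2 Ω} {g₁ g₂ : L2Vec Ω} (h₁ : HasWeakGradient Ω z₁ g₁)
    (h₂ : HasWeakGradient Ω z₂ g₂) (a b : ℝ) :
    HasWeakGradient Ω (a • z₁ + b • z₂) (a • g₁ + b • g₂) := by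
  intro ψ hψ
  have hψ2 := hψ.memLp 2 (volume.restrict Ω)
  have hg2 := hψ.memLp_gradient 2 (volume.restrict Ω)
  have e1 : ∫ x in Ω, (a • z₁ + b • z₂ : L2 Ω) x • gradient ψ x =
      ∫ x in Ω, (a • (z₁ x • gradient ψ x) + b • (z₂ x • gradient ψ x)) := by
    refine integral_congr_ae ?_
    filter_upwards [Lp.coeFn_add (a • z₁) (b • z₂), Lp.coeFn_smul a z₁, Lp.coeFn_smul b z₂]
      with x h h' h''
    rw [h, Pi.add_apply, h', h'', Pi.smul_apply, Pi.smul_apply, add_smul, smul_assoc, smul_assoc]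
  have e2 : ∫ x in Ω, ψ x • (a • g₁ + b • g₂ : L2Vec Ω) x =
      ∫ x in Ω, (a • (ψ x • g₁ x) + b • (ψ x • g₂ x)) := by
    refine integral_congr_ae ?_
    filter_upwards [Lp.coeFn_add (a • g₁) (b • g₂), Lp.coeFn_smul a g₁, Lp.coeFn_smul b g₂]
      with x h h' h''
    rw [h, Pi.add_apply, h', h'', Pi.smul_apply, Pi.smul_apply, smul_add, smul_comm a,
      smul_comm b]
  have i₁ : Integrable (fun x => a • (z₁ x • gradient ψ x)) (volume.restrict Ω) :=
    (integrable_smul_of_memLp_two (Lp.memLp z₁) hg2).smul a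
  have i₂ : Integrable (fun x => b • (z₂ x • gradient ψ x)) (volume.restrict Ω) :=
    (integrable_smul_of_memLp_two (Lp.memLp z₂) hg2).smul b
  have i₃ : Integrable (fun x => a • (ψ x • g₁ x)) (volume.restrict Ω) :=
    (integrable_smul_of_memLp_two hψ2 (Lp.memLp g₁)).smul a
  have i₄ : Integrable (fun x => b • (ψ x • g₂ x)) (volume.restrict Ω) :=
    (integrable_smul_of_memLp_two hψ2 (Lp.memLp g₂)).smul b
  rw [e1, e2, integral_add i₁ i₂, integral_add i₃ i₄, integral_smul, integral_smul,
    integral_smul, integral_smul, h₁ ψ hψ, h₂ ψ hψ]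
  simp only [smul_neg]
  abel

lemma tendsto_eLpNorm_lincomb {α F : Type*} [MeasurableSpace α] [NormedAddCommGroup F]
    [NormedSpace ℝ F] {μ : Measure α} {f₁ f₂ : ℕ → α → F} {f f' : α → F}
    (m₁ : ∀ k, AEStronglyMeasurable (f₁ k) μ) (m₂ : ∀ k, AEStronglyMeasurable (f₂ k) μ)
    (m : AEStronglyMeasurable f μ) (m' : AEStronglyMeasurable f' μ)
    (h₁ : Tendsto (fun k => eLpNorm (fun x => f₁ k x - f x) 2 μ) atTop (𝓝 0))
    (h₂ : Tendsto (fun k => eLpNorm (fun x => f₂ k x - f' x) 2 μ) atTop (𝓝 0)) (a b : ℝ) :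
    Tendsto (fun k => eLpNorm (fun x => (a • f₁ k x + b • f₂ k x) - (a • f x + b • f' x)) 2 μ)
      atTop (𝓝 0) := by
  have t1 := ENNReal.Tendsto.const_mul (a := ‖a‖ₑ) h₁ (Or.inr enorm_ne_top)
  have t2 := ENNReal.Tendsto.const_mul (a := ‖b‖ₑ) h₂ (Or.inr enorm_ne_top)
  refine tendsto_of_tendsto_of_tendsto_of_le_of_le tendsto_const_nhds
    (by simpa using t1.add t2) (fun _ => zero_le) fun k => ?_
  have e : (fun x => (a • f₁ k x + b • f₂ k x) - (a • f x + b • f' x)) =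
      a • (fun x => f₁ k x - f x) + b • fun x => f₂ k x - f' x := by
    ext1 x
    simp only [Pi.add_apply, Pi.smul_apply, smul_sub]
    abel
  beta_reduce
  rw [e]
  refine (eLpNorm_add_le (((m₁ k).sub m).const_smul a) (((m₂ k).sub m').const_smul b)
    (by norm_num)).trans ?_
  rw [eLpNorm_const_smul, eLpNorm_const_smul]
  rfl

lemma HasTrace.lincomb {z₁ z₂ : L2 Ω} {φ₁ φ₂ : E n → ℝ} (h₁ : HasTrace Ω z₁ φ₁)
    (h₂ : HasTrace Ω z₂ φ₂) (a b : ℝ) :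
    HasTrace Ω (a • z₁ + b • z₂) (fun x => a * φ₁ x + b * φ₂ x) := by
  obtain ⟨m₁, g₁, hg₁, ζ₁, hζ₁, hlim₁, htr₁⟩ := h₁
  obtain ⟨m₂, g₂, hg₂, ζ₂, hζ₂, hlim₂, htr₂⟩ := h₂
  refine ⟨(m₁.const_mul a).add (m₂.const_mul b), a • g₁ + b • g₂, hg₁.lincomb hg₂ a b,
    fun k x => a * ζ₁ k x + b * ζ₂ k x,
    fun k => (contDiff_const.mul (hζ₁ k)).add (contDiff_const.mul (hζ₂ k)), ⟨?_, ?_⟩, ?_⟩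
  · refine (tendsto_eLpNorm_lincomb (fun k => (hζ₁ k).continuous.aestronglyMeasurable)
      (fun k => (hζ₂ k).continuous.aestronglyMeasurable) (Lp.aestronglyMeasurable z₁)
      (Lp.aestronglyMeasurable z₂) hlim₁.1 hlim₂.1 a b).congr fun k => eLpNorm_congr_ae ?_
    filter_upwards [Lp.coeFn_add (a • z₁) (b • z₂), Lp.coeFn_smul a z₁, Lp.coeFn_smul b z₂]
      with x h h' h''
    rw [h, Pi.add_apply, h', h'', Pi.smul_apply, Pi.smul_apply, smul_eq_mul, smul_eq_mul]
  · refine (tendsto_eLpNorm_lincomb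
      (fun k => (continuous_gradient (hζ₁ k)).aestronglyMeasurable)
      (fun k => (continuous_gradient (hζ₂ k)).aestronglyMeasurable) (Lp.aestronglyMeasurable g₁)
      (Lp.aestronglyMeasurable g₂) hlim₁.2 hlim₂.2 a b).congr fun k => eLpNorm_congr_ae ?_
    filter_upwards [Lp.coeFn_add (a • g₁) (b • g₂), Lp.coeFn_smul a g₁, Lp.coeFn_smul b g₂]
      with x h h' h''
    have d₁ := (hζ₁ k).differentiable (by simp) x
    have d₂ := (hζ₂ k).differentiable (by simp) x
    rw [h, Pi.add_apply, h', h'', Pi.smul_apply, Pi.smul_apply,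
      gradient_add (d₁.const_mul a) (d₂.const_mul b), gradient_const_mul a d₁,
      gradient_const_mul b d₂]
  · exact tendsto_eLpNorm_lincomb (fun k => (hζ₁ k).continuous.aestronglyMeasurable)
      (fun k => (hζ₂ k).continuous.aestronglyMeasurable) m₁.1 m₂.1 htr₁ htr₂ a b

lemma memLp_top_div {q : E n → ℝ} (hq : MemLp q ⊤ (volume.restrict Ω)) (ε : ℝ) :
    MemLp (fun x => q x / ε) ⊤ (volume.restrict Ω) := by
  simpa only [div_eq_mul_inv] using hq.mul_const ε⁻¹

lemma SolvesDirichlet.lincomb {ε : ℝ} {q φ₁ φ₂ : E n → ℝ} (hq : MemLp q ⊤ (volume.restrict Ω))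
    {z₁ z₂ : L2 Ω} (h₁ : SolvesDirichlet Ω ε q φ₁ z₁) (h₂ : SolvesDirichlet Ω ε q φ₂ z₂)
    (a b : ℝ) :
    SolvesDirichlet Ω ε q (fun x => a * φ₁ x + b * φ₂ x) (a • z₁ + b • z₂) := by
  refine ⟨?_, h₁.2.lincomb h₂.2 a b⟩
  obtain ⟨g₁, hg₁, hw₁⟩ := h₁.1
  obtain ⟨g₂, hg₂, hw₂⟩ := h₂.1
  refine ⟨a • g₁ + b • g₂, hg₁.lincomb hg₂ a b, fun ψ h hψ => ?_⟩
  have e₁ := hw₁ ψ h hψ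
  have e₂ := hw₂ ψ h hψ
  have hb := memLp_top_div hq ε
  rw [← L2.inner_def, ← inner_mulL2 hb] at e₁ e₂ ⊢
  simp only [map_add, map_smul, inner_add_left, inner_smul_left, conj_trivial]
  linear_combination a * e₁ + b * e₂

lemma exists_solvesDirichlet (hn : 1 ≤ n) (hΩ : IsBoundedLipschitzDomain Ω) {ε : ℝ} (hε : 0 < ε)
    {q φ : E n → ℝ} (hq : MemLp q ⊤ (volume.restrict Ω)) (hq0 : ∀ x, 0 ≤ q x)
    (hφ : MemHHalf Ω φ) : ∃ z, SolvesDirichlet Ω ε q φ z := by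
  obtain ⟨u₀, hφ2, g₀, hg₀, ζ, hζ, hlim, htr⟩ := hφ
  obtain ⟨w, k, hwk, hw⟩ := exists_correction hn hΩ.isBounded (memLp_top_div hq ε)
    (Eventually.of_forall fun x => div_nonneg (hq0 x) hε.le) u₀ g₀
  obtain ⟨hk, ψ, hψ, hlimψ⟩ := id hwk
  -- The test functions approximating w vanish on the frontier, so adding w leaves the trace of u₀
  -- unchanged.
  have hzero : HasTrace Ω w (fun _ => 0) := by
    refine ⟨MemLp.zero', k, hk, ψ, fun j => (hψ j).contDiff, hlimψ, ?_⟩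
    have : ∀ j, eLpNorm (fun x => ψ j x - 0) 2 (surfaceMeasure Ω) = 0 := fun j => by
      rw [eLpNorm_congr_ae (g := 0), eLpNorm_zero]
      filter_upwards [ae_restrict_mem isClosed_frontier.measurableSet] with x hx
      rw [sub_zero, (hψ j).eq_zero (hΩ.notMem_of_mem_frontier hx), Pi.zero_apply]
    exact tendsto_const_nhds.congr fun j => (this j).symm
  have htrace := HasTrace.lincomb ⟨hφ2, g₀, hg₀, ζ, hζ, hlim, htr⟩ hzero 1 1
  have hgrad := hg₀.lincomb hk 1 1
  simp only [one_smul, one_mul, add_zero] at htrace hgrad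
  exact ⟨u₀ + w, ⟨g₀ + k, hgrad, hw⟩, htrace⟩

lemma SolvesDirichlet.unique (hn : 1 ≤ n) (hΩ : IsBoundedLipschitzDomain Ω) {ε : ℝ} (hε : 0 < ε)
    {q φ : E n → ℝ} (hq : MemLp q ⊤ (volume.restrict Ω)) (hq0 : ∀ x, 0 ≤ q x) {z₁ z₂ : L2 Ω}
    (h₁ : SolvesDirichlet Ω ε q φ z₁) (h₂ : SolvesDirichlet Ω ε q φ z₂) : z₁ = z₂ := by
  -- By linearity z - z' solves the problem with zero boundary data, so the maximum principle at
  -- level 0 applies.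
  have key : ∀ {z z' : L2 Ω}, SolvesDirichlet Ω ε q φ z → SolvesDirichlet Ω ε q φ z' →
      ∀ᵐ x ∂volume.restrict Ω, z x ≤ z' x := fun {z z'} h h' => by
    have hd := (h.lincomb hq h' 1 (-1)).ae_le hn hΩ hε hq0 le_rfl
      (Eventually.of_forall fun x => by simp)
    filter_upwards [hd, Lp.coeFn_add ((1 : ℝ) • z) ((-1 : ℝ) • z'), Lp.coeFn_smul (1 : ℝ) z,
      Lp.coeFn_smul (-1 : ℝ) z'] with x hx e e' e''
    rw [e, Pi.add_apply, e', e'', Pi.smul_apply, Pi.smul_apply, smul_eq_mul, smul_eq_mul] at hx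
    linarith
  refine Lp.ext ?_
  filter_upwards [key h₁ h₂, key h₂ h₁] with x h h' using le_antisymm h h'

lemma SolvesDirichlet.ae_nonneg (hn : 1 ≤ n) (hΩ : IsBoundedLipschitzDomain Ω) {ε : ℝ}
    (hε : 0 < ε) {q φ : E n → ℝ} (hq : MemLp q ⊤ (volume.restrict Ω)) (hq0 : ∀ x, 0 ≤ q x)
    {z : L2 Ω} (hz : SolvesDirichlet Ω ε q φ z) (hφ : ∀ᵐ x ∂surfaceMeasure Ω, 0 ≤ φ x) :
    ∀ᵐ x ∂volume.restrict Ω, 0 ≤ z x := by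
  -- The maximum principle at level 0 for -z, written as 0 · z + (-1) · z.
  have hd := (hz.lincomb hq hz 0 (-1)).ae_le hn hΩ hε hq0 le_rfl (by
    filter_upwards [hφ] with x hx
    linarith)
  filter_upwards [hd, Lp.coeFn_add ((0 : ℝ) • z) ((-1 : ℝ) • z), Lp.coeFn_smul (0 : ℝ) z,
    Lp.coeFn_smul (-1 : ℝ) z] with x hx e e' e''
  rw [e, Pi.add_apply, e', e'', Pi.smul_apply, Pi.smul_apply, smul_eq_mul, smul_eq_mul] at hx
  linarith

end Dirichlet

/-! ### From one equation to the two iteration maps. -/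

section Steps

variable {n : ℕ} {Ω : Set (E n)} {φ : Fin 3 → E n → ℝ}

lemma bound_nonneg (Ω : Set (E n)) (φ : Fin 3 → E n → ℝ) : 0 ≤ bound Ω φ :=
  ENNReal.toReal_nonneg.trans (Finset.le_sup'
    (fun i : Fin 3 => (eLpNorm (φ i) ⊤ (surfaceMeasure Ω)).toReal) (Finset.mem_univ 0))

lemma ae_le_bound (hφ : ∀ i, MemLp (φ i) ⊤ (surfaceMeasure Ω)) (i : Fin 3) :
    ∀ᵐ x ∂surfaceMeasure Ω, φ i x ≤ bound Ω φ := by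
  filter_upwards [ae_le_eLpNormEssSup (f := φ i) (μ := surfaceMeasure Ω)] with x hx
  rw [← eLpNorm_exponent_top] at hx
  -- Finiteness of the norm matters: `toReal` would turn an infinite norm into 0.
  have h := ENNReal.toReal_mono (hφ i).2.ne hx
  rw [toReal_enorm] at h
  exact (le_abs_self _).trans (h.trans (Finset.le_sup'
    (fun i : Fin 3 => (eLpNorm (φ i) ⊤ (surfaceMeasure Ω)).toReal) (Finset.mem_univ i)))

lemma memLp_top_of_ae_mem {M : ℝ} {z : L2 Ω}
    (hz : ∀ᵐ x ∂volume.restrict Ω, 0 ≤ z x ∧ z x ≤ M) : MemLp z ⊤ (volume.restrict Ω) := by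
  refine memLp_top_of_bound (Lp.aestronglyMeasurable z) M ?_
  filter_upwards [hz] with x hx
  rw [Real.norm_eq_abs, abs_of_nonneg hx.1]
  exact hx.2

lemma memLp_top_mul {f g : E n → ℝ} {μ : Measure (E n)} (hf : MemLp f ⊤ μ) (hg : MemLp g ⊤ μ) :
    MemLp (fun x => f x * g x) ⊤ μ :=
  hg.mul hf

/-- Well-posedness of the Dirichlet problem with data in `[0, M]`, and invariance of `[0, M]`. -/
lemma existsUnique_solvesDirichlet (hn : 1 ≤ n) (hΩ : IsBoundedLipschitzDomain Ω) {ε : ℝ}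
    (hε : 0 < ε) (hφ_half : ∀ i, MemHHalf Ω (φ i)) (hφ_bdd : ∀ i, MemLp (φ i) ⊤ (surfaceMeasure Ω))
    (hφ_nonneg : ∀ i, ∀ᵐ x ∂surfaceMeasure Ω, 0 ≤ φ i x) (i : Fin 3) {q : E n → ℝ}
    (hq : MemLp q ⊤ (volume.restrict Ω)) (hq0 : ∀ x, 0 ≤ q x) :
    ∃ z, (∀ z', SolvesDirichlet Ω ε q (φ i) z' ↔ z' = z) ∧
      ∀ᵐ x ∂volume.restrict Ω, 0 ≤ z x ∧ z x ≤ bound Ω φ := by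
  obtain ⟨z, hz⟩ := exists_solvesDirichlet hn hΩ hε hq hq0 (hφ_half i)
  refine ⟨z, fun z' => ⟨fun hz' => hz'.unique hn hΩ hε hq hq0 hz, fun e => e ▸ hz⟩, ?_⟩
  filter_upwards [hz.ae_nonneg hn hΩ hε hq hq0 (hφ_nonneg i),
    hz.ae_le hn hΩ hε hq0 (bound_nonneg Ω φ) (ae_le_bound hφ_bdd i)] with x h h' using ⟨h, h'⟩

/-- When exactly one element satisfies P, the choice operator must return it; this identifies
`jacobiMap` and `gaussSeidelMap` with the solutions constructed. -/
lemma iff_eq_epsilon {α : Type*} [Nonempty α] {P : α → Prop} {a : α} (h : ∀ b, P b ↔ b = a) :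
    Classical.epsilon P = a :=
  (h _).1 (Classical.epsilon_spec ⟨a, (h a).2 rfl⟩)

end Steps

end Segregation

end

theorem lemma1p5 {n : ℕ} (hn : 1 ≤ n) (Ω : Set (Segregation.E n))
    (hΩ : Segregation.IsBoundedLipschitzDomain Ω) (ε : ℝ) (hε : 0 < ε)
    (φ : Fin 3 → Segregation.E n → ℝ)
    (hφ_half : ∀ i, Segregation.MemHHalf Ω (φ i))
    (hφ_bdd : ∀ i, MemLp (φ i) ∞ (Segregation.surfaceMeasure Ω))
    (hφ_nonneg : ∀ i, ∀ᵐ x ∂(Segregation.surfaceMeasure Ω), 0 ≤ φ i x) :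
    ∀ u ∈ Segregation.orderInterval Ω φ,
      ((∀ v, Segregation.IsJacobiStep Ω ε φ u v ↔ v = Segregation.jacobiMap Ω ε φ u) ∧
        Segregation.jacobiMap Ω ε φ u ∈ Segregation.orderInterval Ω φ) ∧
      ((∀ v, Segregation.IsGaussSeidelStep Ω ε φ u v ↔ v = Segregation.gaussSeidelMap Ω ε φ u) ∧
        Segregation.gaussSeidelMap Ω ε φ u ∈ Segregation.orderInterval Ω φ) := by
  intro u hu
  have solve := fun (i : Fin 3) {q : Segregation.E n → ℝ} =>
    Segregation.existsUnique_solvesDirichlet hn hΩ hε hφ_half hφ_bdd hφ_nonneg i (q := q)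
  have mu := fun i => Segregation.memLp_top_of_ae_mem (hu i)
  have msq : ∀ {f : Segregation.E n → ℝ}, MemLp f ⊤ (volume.restrict Ω) →
      MemLp (fun x => f x ^ 2) ⊤ (volume.restrict Ω) := fun {f} hf => by
    simpa only [sq] using Segregation.memLp_top_mul hf hf
  have mhalf : ∀ {f : Segregation.E n → ℝ}, MemLp f ⊤ (volume.restrict Ω) →
      MemLp (fun x => f x / 2) ⊤ (volume.restrict Ω) := fun {f} hf =>
    Segregation.memLp_top_div hf 2
  constructor
  -- The Jacobi system decouples into three independent scalar problems.
  · choose v hv hvK using fun i : Fin 3 =>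
      solve i (msq (Segregation.memLp_top_mul (mu (i + 1)) (mu (i + 2)))) fun x => sq_nonneg _
    have h : ∀ v', Segregation.IsJacobiStep Ω ε φ u v' ↔ v' = v := fun v' =>
      (forall_congr' fun i => hv i (v' i)).trans funext_iff.symm
    rw [Segregation.jacobiMap, Segregation.iff_eq_epsilon h]
    exact ⟨h, hvK⟩
  · obtain ⟨v₀, h₀, hK₀⟩ := solve 0 (msq (Segregation.memLp_top_mul (mu 1) (mu 2)))
      fun x => sq_nonneg _
    -- The bound 0 ≤ v₀ ≤ M makes the coefficient of the next equation bounded; the same happens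
    -- with v₁ below.
    have m₀ := Segregation.memLp_top_of_ae_mem hK₀
    obtain ⟨v₁, h₁, hK₁⟩ := solve 1
      (mhalf (Segregation.memLp_top_mul (msq (mu 2)) ((msq (mu 0)).add (msq m₀))))
      fun x => div_nonneg (mul_nonneg (sq_nonneg _) (add_nonneg (sq_nonneg _) (sq_nonneg _)))
        zero_le_two
    have m₁ := Segregation.memLp_top_of_ae_mem hK₁
    obtain ⟨v₂, h₂, hK₂⟩ := solve 2
      (mhalf ((msq (Segregation.memLp_top_mul (mu 0) (mu 1))).add
        (msq (Segregation.memLp_top_mul m₀ m₁))))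
      fun x => div_nonneg (add_nonneg (sq_nonneg _) (sq_nonneg _)) zero_le_two
    -- Uniqueness is applied in order: each component must be identified before the coefficient of
    -- the next equation is known.
    have h : ∀ v', Segregation.IsGaussSeidelStep Ω ε φ u v' ↔ v' = ![v₀, v₁, v₂] := fun v' => by
      constructor
      · rintro ⟨e₀, e₁, e₂⟩
        have e₀' := (h₀ _).1 e₀
        rw [e₀'] at e₁ e₂
        have e₁' := (h₁ _).1 e₁
        rw [e₁'] at e₂
        have e₂' := (h₂ _).1 e₂
        ext1 i
        fin_cases i <;> assumption
      · rintro rfl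
        exact ⟨(h₀ _).2 rfl, (h₁ _).2 rfl, (h₂ _).2 rfl⟩
    rw [Segregation.gaussSeidelMap, Segregation.iff_eq_epsilon h]
    refine ⟨h, fun i => ?_⟩
    fin_cases i
    exacts [hK₀, hK₁, hK₂]
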